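/- Let $d\ge 2$ and let $D\subset\mathbb C^d$ be a bounded strongly $\mathbb C$-convex $\mathcal C^2$ domain: $D$ is connected and $D=\{\rho<0\}$ for a $\mathcal C^2$ function $\rho:\mathbb C^d\to\mathbb R$ (a defining function) whose gradient does not vanish on the boundary $bD$ and whose real Hessian is, at every $w\in bD$, positive definite on the complex tangent space $\{v\in\mathbb C^d:\langle\partial\rho(w),v\rangle=0\}$, where $\langle z,w\rangle=\sum_j z_jw_j$ and $\partial\rho=(\partial\rho/\partial z_1,\dots,\partial\rho/\partial z_d)$. For a finite set $\varphi\subset bD$ and a function $\boldsymbol\delta:bD\to(0,\infty)$, let $P(\varphi;\boldsymbol\delta)$ be the union of those connected components of $$\bigcap_{w\in\varphi}\Big\{z\in\mathbb C^d:\ \frac{|\langle\partial\rho(w),w-z\rangle|}{\|\partial\rho(w)\|}>\boldsymbol\delta(w)\Big\}$$ that intersect $D$ (this does not depend on the choice of the defining function $\rho$). Let $\sigma$ be the Euclidean surface area measure on $bD$ and let $f:bD\to(0,\infty)$ be a bounded probability density with respect to $\sigma$ that is bounded away from $0$. Let $W^1,W^2,\dots$ be i.i.d. random points of $bD$ with density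 $f$, let $N_n$ be a Poisson random variable with mean $n$ that is independent of $(W^i)_{i\ge1}$, and set $\eta_n=\{W^1,\dots,W^{N_n}\}$ (Poisson process with intensity measure $nf\sigma$) and $\beta_n=\{W^1,\dots,W^n\}$ (binomial process). For a continuous function $g:bD\to(0,\infty)$ put $\boldsymbol\delta_n(w)=g(w)\left(\frac{\log n}{n}\right)^{1/d}$. Then the following hold. (a) There is a constant $c>0$, depending only on $D$ and $f$, such that for every continuous $g:bD\to(0,\infty)$ with $\min_{bD}g<c$, $$\mathbb P\big(P(\eta_n;\boldsymbol\delta_n)\subset D\big)\to 0\quad\text{as } n\to\infty.$$ (b) For every $\alpha>0$ there is a constant $C>0$, depending only on $D$, $f$ and $\alpha$, such that for every continuous $g:bD\to(0,\infty)$ with $\min_{bD}g>C$, $$\mathbb P\big(P(\eta_n;\boldsymbol\delta_n)\subset D\big)=1-O(n^{-\alpha})\quad\text{as } n\to\infty.$$ (c) Both (a) and (b) also hold with $\eta_n$ replaced by $\beta_n$. -/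

import Mathlib

open MeasureTheory ProbabilityTheory Filter Topology Asymptotics
open scoped MeasureTheory NNReal

noncomputable section

/-- `ℂ^d` with its Euclidean norm. -/
abbrev Cd (d : ℕ) : Type := EuclideanSpace ℂ (Fin d)

/-- The complex gradient `∂ρ = (∂ρ/∂z_1, …, ∂ρ/∂z_d)` of a real function, where
`∂/∂z_j = (∂/∂x_j - i ∂/∂y_j) / 2`. -/
def complexGradient {d : ℕ} (ρ : Cd d → ℝ) (w : Cd d) : Cd d :=
  WithLp.toLp 2 fun j =>
    ((fderiv ℝ ρ w (EuclideanSpace.single j (1 : ℂ)) : ℂ)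
      - Complex.I * (fderiv ℝ ρ w (EuclideanSpace.single j Complex.I) : ℂ)) / 2

/-- The bilinear (not Hermitian) pairing `⟨z, w⟩ = z_1 w_1 + ⋯ + z_d w_d`. -/
def bilinPairing {d : ℕ} (z w : Cd d) : ℂ := ∑ j, z j * w j

/-- `ρ` is a `C²` defining function of `D`: a `C²` function on `ℂ^d` with `D = {ρ < 0}` whose
gradient does not vanish on the boundary of `D`. -/
structure IsDefiningFunction {d : ℕ} (D : Set (Cd d)) (ρ : Cd d → ℝ) : Prop where
  contDiff : ContDiff ℝ 2 ρ
  eq_sublevel : D = {z | ρ z < 0}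
  fderiv_ne_zero : ∀ w ∈ frontier D, fderiv ℝ ρ w ≠ 0

/-- The complex tangent space `{v | ⟨∂ρ(w), v⟩ = 0}`. -/
def complexTangentSpace {d : ℕ} (ρ : Cd d → ℝ) (w : Cd d) : Set (Cd d) :=
  {v | bilinPairing (complexGradient ρ w) v = 0}

/-- A strongly `ℂ`-convex `C²` domain: a connected (open) set with a `C²` defining function whose
real Hessian is positive definite on every complex tangent space of the boundary. In complex
coordinates, half of this Hessian at `(v, v)` is
`∑ ρ_{z_j \bar z_k}(w) v_j \bar v_k + Re ∑ ρ_{z_j z_k}(w) v_j v_k`. -/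
structure IsStronglyCConvexDomain {d : ℕ} (D : Set (Cd d)) : Prop where
  isConnected : IsConnected D
  exists_defining : ∃ ρ : Cd d → ℝ, IsDefiningFunction D ρ ∧
    ∀ w ∈ frontier D, ∀ v ∈ complexTangentSpace ρ w, v ≠ 0 →
      0 < fderiv ℝ (fderiv ℝ ρ) w v v

/-- `L(z, w) = ⟨∂ρ(w), w - z⟩ / ‖∂ρ(w)‖`; its modulus is the distance of `z` from the complex
tangent hyperplane to the boundary at `w`. -/
def tangentFunctional {d : ℕ} (ρ : Cd d → ℝ) (z w : Cd d) : ℂ :=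
  bilinPairing (complexGradient ρ w) (w - z) / (‖complexGradient ρ w‖ : ℂ)

/-- The intersection over the source points `w ∈ φ` of the sets `{z | |L(z, w)| > δ(w)}`. -/
def tubeComplement {d : ℕ} (D : Set (Cd d)) (ρ : Cd d → ℝ) (φ : Set (frontier D))
    (δ : frontier D → ℝ) : Set (Cd d) :=
  {z | ∀ w ∈ φ, δ w < ‖tangentFunctional ρ z w‖}

/-- The polyhedron `P(φ; δ)` induced by the source set `φ` and the size function `δ`: the union of
those connected components of `tubeComplement D ρ φ δ` that intersect `D`. -/
def inducedPolyhedron {d : ℕ} (D : Set (Cd d)) (ρ : Cd d → ℝ) (φ : Set (frontier D))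
    (δ : frontier D → ℝ) : Set (Cd d) :=
  {z | z ∈ tubeComplement D ρ φ δ ∧
    (connectedComponentIn (tubeComplement D ρ φ δ) z ∩ D).Nonempty}

/-- The Euclidean surface area measure on the boundary of `D ⊆ ℂ^d`: the `(2d-1)`-dimensional
Hausdorff measure, normalized so as to agree with Lebesgue measure on `ℝ^(2d-1)`. -/
def surfaceMeasure {d : ℕ} (D : Set (Cd d)) : Measure (frontier D) := μHE[2 * d - 1]

/-- A probability density with respect to surface area that is bounded and bounded away from `0`. -/
structure IsBoundedDensity {d : ℕ} (D : Set (Cd d)) (f : frontier D → ℝ) : Prop where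
  measurable : Measurable f
  bounded : ∃ M : ℝ, ∀ w, f w ≤ M
  bounded_away : ∃ m : ℝ, 0 < m ∧ ∀ w, m ≤ f w
  integral_eq_one : ∫ w, f w ∂(surfaceMeasure D) = 1

/-- The law `f σ` on the boundary. -/
def sampleLaw {d : ℕ} (D : Set (Cd d)) (f : frontier D → ℝ) : Measure (frontier D) :=
  (surfaceMeasure D).withDensity fun w => ENNReal.ofReal (f w)

/-- `W 0, W 1, …` are i.i.d. random boundary points with density `f`. -/
structure IsIIDSample {d : ℕ} {D : Set (Cd d)} (f : frontier D → ℝ) {Ω : Type*}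
    [MeasurableSpace Ω] (μ : Measure Ω) (W : ℕ → Ω → frontier D) : Prop where
  law : ∀ i, HasLaw (W i) (sampleLaw D f) μ
  indep : iIndepFun W μ

/-- For every `n`, the random variable `N n` is Poisson with mean `n` and independent of the
sequence `W`. -/
structure IsPoissonCount {d : ℕ} {D : Set (Cd d)} {Ω : Type*} [MeasurableSpace Ω]
    (μ : Measure Ω) (W : ℕ → Ω → frontier D) (N : ℕ → Ω → ℕ) : Prop where
  law : ∀ n, HasLaw (N n) (poissonMeasure (n : ℝ≥0)) μ
  indep : ∀ n, IndepFun (N n) (fun ω i => W i ω) μ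

/-- The binomial process: the random set consisting of the first `n` sample points. -/
def binomialProcess {d : ℕ} {D : Set (Cd d)} {Ω : Type*} (W : ℕ → Ω → frontier D) (n : ℕ)
    (ω : Ω) : Set (frontier D) :=
  (fun i => W i ω) '' Set.Iio n

/-- The Poisson process: the random set consisting of the first `N n` sample points. -/
def poissonProcess {d : ℕ} {D : Set (Cd d)} {Ω : Type*} (W : ℕ → Ω → frontier D)
    (N : ℕ → Ω → ℕ) (n : ℕ) (ω : Ω) : Set (frontier D) :=
  (fun i => W i ω) '' Set.Iio (N n ω)

/-- The size function `g(w) (log n / n)^(1/d)`. -/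
def scaledSize {d : ℕ} {D : Set (Cd d)} (g : frontier D → ℝ) (n : ℕ) (w : frontier D) : ℝ :=
  g w * (Real.log n / n) ^ (1 / (d : ℝ))

/-- The probability that the polyhedron induced by the random source set `η` is contained
in `D`. -/
def containmentProb {d : ℕ} (D : Set (Cd d)) (ρ : Cd d → ℝ) {Ω : Type*} [MeasurableSpace Ω]
    (μ : Measure Ω) (η : Ω → Set (frontier D)) (δ : frontier D → ℝ) : ℝ :=
  μ.real {ω | inducedPolyhedron D ρ (η ω) δ ⊆ D}

end

/-! The polyhedron leaves `D` exactly when the tubes around the complex tangent hyperplanes at the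
sample points fail to cover the boundary of `D`: a boundary point outside all tubes belongs to the
polyhedron (`not_disjoint_of_inducedPolyhedron_subset`), and if every boundary point lies in a tube,
no component of the complement of the tubes can cross the boundary
(`inducedPolyhedron_subset_of_cover`). So both parts concern random coverings of the boundary by
the caps `{w | |L(z, w)| ≤ δ(w)}`, and the point is that a cap of size `s` has surface area
comparable to `s ^ d`; for `s = (log n / n) ^ (1 / d)` the mean number of sample points in a cap is
of order `log n`, the critical order for coverings.

The lower bound `exists_le_surfaceMeasure` is local: the boundary is a `C²` graph over its tangent
space, over which the cap covers a box of side `√s` in the `2d - 2` complex tangential directions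
and of side `s` in the remaining one. The upper bound `exists_surfaceMeasure_le` needs
`|L(z, w)| ≥ c |z - w|²` for all pairs of boundary points
(`exists_sq_le_norm_tangentFunctional`). Near the diagonal this is the Hessian condition. Away from
the diagonal it says that a complex tangent hyperplane touches the closure of `D` at one point only
(`eq_of_mem_closure_of_pairing_eq_zero`), a global property that uses the connectedness of `D`:
every complex line meets `D` in a connected set (`joinedIn_slice`), because the pairs of points of
`D` that are joined inside their complex line form a set that is open and closed in `D × D`. A
slice of `D` can change its topology only at a tangency, where by the Hessian condition it is
an isolated point.

The binomial and the Poisson process enter only through their void probabilities, for which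
`HasVoidBounds` records what both have in common. For small tubes, polynomially many boundary
points near a point where `g` is small have disjoint caps, each of them missed with probability at
least `n ^ (-1/4)`; as these events are nonpositively correlated, the second moment method
(`measureReal_forall_notMem_le_inv_sum`) shows that one of them occurs with high probability. For
large tubes, a union bound over a Euclidean net of the boundary with `O(n²)` points shows that the
tubes cover the boundary, since `L` is `1`-Lipschitz in its first argument. -/

/-! ### The complex gradient and its pairing -/

section Pairing

variable {d : ℕ}

lemma bilinPairing_add (a v w : Cd d) :
    bilinPairing a (v + w) = bilinPairing a v + bilinPairing a w := by
  simp [bilinPairing, mul_add, Finset.sum_add_distrib]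

lemma bilinPairing_smul (a v : Cd d) (c : ℂ) :
    bilinPairing a (c • v) = c * bilinPairing a v := by
  simp only [bilinPairing, Finset.mul_sum, PiLp.smul_apply, smul_eq_mul]
  exact Finset.sum_congr rfl fun _ _ => by ring

lemma bilinPairing_neg (a v : Cd d) : bilinPairing a (-v) = -bilinPairing a v := by
  simp [bilinPairing]

/-- Every vector is the real combination of the `2d` vectors `e_j`, `i e_j`. -/
lemma clm_apply_eq_sum (φ : Cd d →L[ℝ] ℝ) (v : Cd d) :
    φ v = ∑ j, ((v j).re * φ (EuclideanSpace.single j (1 : ℂ))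
      + (v j).im * φ (EuclideanSpace.single j Complex.I)) := by
  have hv : v = ∑ j, ((v j).re • (EuclideanSpace.single j (1 : ℂ) : Cd d)
      + (v j).im • (EuclideanSpace.single j Complex.I : Cd d)) := by
    ext i
    simp [Finset.sum_add_distrib, Pi.single_apply, Complex.re_add_im]
  conv_lhs => rw [hv]
  simp [map_sum, map_add, map_smul]

/-- The pairing with the complex gradient in terms of the real differential. -/
lemma bilinPairing_complexGradient (ρ : Cd d → ℝ) (w v : Cd d) :
    bilinPairing (complexGradient ρ w) v
      = ((fderiv ℝ ρ w v : ℂ) - Complex.I * (fderiv ℝ ρ w (Complex.I • v) : ℂ)) / 2 := by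
  rw [clm_apply_eq_sum (fderiv ℝ ρ w) v, clm_apply_eq_sum (fderiv ℝ ρ w) (Complex.I • v)]
  simp only [bilinPairing, complexGradient]
  push_cast
  rw [Finset.mul_sum, ← Finset.sum_sub_distrib, Finset.sum_div]
  refine Finset.sum_congr rfl fun j _ => ?_
  apply Complex.ext <;> simp <;> ring

lemma fderiv_eq_two_re (ρ : Cd d → ℝ) (w v : Cd d) :
    fderiv ℝ ρ w v = 2 * (bilinPairing (complexGradient ρ w) v).re := by
  rw [bilinPairing_complexGradient]; simp; ring

lemma norm_bilinPairing_le (a v : Cd d) : ‖bilinPairing a v‖ ≤ ‖a‖ * ‖v‖ := by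
  have h : bilinPairing a v = inner ℂ (WithLp.toLp 2 fun j => (starRingEnd ℂ) (a j) : Cd d) v := by
    simp [bilinPairing, PiLp.inner_apply, mul_comm]
  have hn : ‖(WithLp.toLp 2 fun j => (starRingEnd ℂ) (a j) : Cd d)‖ = ‖a‖ := by
    simp [EuclideanSpace.norm_eq]
  rw [h, ← hn]
  exact norm_inner_le_norm _ _

lemma complexGradient_ne_zero {ρ : Cd d → ℝ} {w : Cd d} (h : fderiv ℝ ρ w ≠ 0) :
    complexGradient ρ w ≠ 0 := by
  intro h0
  apply h
  ext v
  rw [fderiv_eq_two_re, h0]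
  simp [bilinPairing]

/-- The pairing varies with the base point no more than the real differential does. -/
lemma norm_bilinPairing_sub_le (ρ : Cd d → ℝ) (w z v : Cd d) :
    ‖bilinPairing (complexGradient ρ w) v - bilinPairing (complexGradient ρ z) v‖
      ≤ ‖fderiv ℝ ρ w - fderiv ℝ ρ z‖ * ‖v‖ := by
  have e : bilinPairing (complexGradient ρ w) v - bilinPairing (complexGradient ρ z) v
      = (((fderiv ℝ ρ w - fderiv ℝ ρ z) v : ℝ) : ℂ) / 2
        - Complex.I * (((fderiv ℝ ρ w - fderiv ℝ ρ z) (Complex.I • v) : ℝ) : ℂ) / 2 := by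
    simp only [bilinPairing_complexGradient, sub_apply]
    push_cast
    ring
  have h1 := (fderiv ℝ ρ w - fderiv ℝ ρ z).le_opNorm v
  have h2 := (fderiv ℝ ρ w - fderiv ℝ ρ z).le_opNorm (Complex.I • v)
  rw [norm_smul, Complex.norm_I, one_mul] at h2
  rw [e]
  refine (norm_sub_le _ _).trans ?_
  simp only [norm_div, norm_mul, Complex.norm_I, Complex.norm_real, one_mul]
  norm_num
  simp only [sub_apply, Real.norm_eq_abs] at h1 h2
  linarith

lemma continuous_complexGradient {ρ : Cd d → ℝ} (h : ContDiff ℝ 2 ρ) :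
    Continuous (complexGradient ρ) := by
  have h1 : Continuous (fderiv ℝ ρ) := h.continuous_fderiv (by norm_num)
  unfold complexGradient
  refine (PiLp.continuous_toLp 2 _).comp (continuous_pi fun j => ?_)
  fun_prop

lemma continuous_bilinPairing : Continuous fun p : Cd d × Cd d => bilinPairing p.1 p.2 := by
  unfold bilinPairing
  fun_prop

end Pairing

/-! ### The boundary of a sublevel set and independence of the defining function -/

section Boundary

variable {d : ℕ} {D : Set (Cd d)} {ρ : Cd d → ℝ}

namespace IsDefiningFunction

lemma isOpen (h : IsDefiningFunction D ρ) : IsOpen D := by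
  rw [h.eq_sublevel]
  exact isOpen_lt h.contDiff.continuous continuous_const

lemma mem_iff (h : IsDefiningFunction D ρ) {z : Cd d} : z ∈ D ↔ ρ z < 0 := by
  rw [h.eq_sublevel]; rfl

lemma nonpos_of_mem_closure (h : IsDefiningFunction D ρ) {z : Cd d} (hz : z ∈ closure D) :
    ρ z ≤ 0 := by
  have : closure D ⊆ {z | ρ z ≤ 0} :=
    closure_minimal (fun z hz => (h.mem_iff.1 hz).le)
      (isClosed_le h.contDiff.continuous continuous_const)
  exact this hz

lemma notMem_of_mem_frontier (h : IsDefiningFunction D ρ) {w : Cd d} (hw : w ∈ frontier D) :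
    w ∉ D := fun hD => by
  rw [h.isOpen.frontier_eq] at hw
  exact hw.2 hD

lemma eq_zero_of_mem_frontier (h : IsDefiningFunction D ρ) {w : Cd d} (hw : w ∈ frontier D) :
    ρ w = 0 := by
  have h1 := h.nonpos_of_mem_closure (frontier_subset_closure hw)
  have h2 : ¬ ρ w < 0 := fun hlt => h.notMem_of_mem_frontier hw (h.mem_iff.2 hlt)
  linarith

lemma hasFDerivAt (h : IsDefiningFunction D ρ) (w : Cd d) : HasFDerivAt ρ (fderiv ℝ ρ w) w :=
  (h.contDiff.differentiable (by norm_num) w).hasFDerivAt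

lemma complexGradient_ne_zero (h : IsDefiningFunction D ρ) {w : Cd d} (hw : w ∈ frontier D) :
    complexGradient ρ w ≠ 0 :=
  _root_.complexGradient_ne_zero (h.fderiv_ne_zero w hw)

end IsDefiningFunction

/-- Moving in a direction in which `ρ` strictly decreases at `p` decreases `ρ`, uniformly over
starting points near `p`. -/
lemma exists_forall_add_smul_lt (hρ : ContDiff ℝ 2 ρ) {p ξ : Cd d} (hξ : fderiv ℝ ρ p ξ < 0) :
    ∃ t₀ > 0, ∀ᶠ q in 𝓝 p, ∀ t ∈ Set.Ioc (0 : ℝ) t₀, ρ (q + t • ξ) < ρ q := by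
  have hs := (hρ.hasStrictFDerivAt (x := p) (by norm_num)).isLittleO
  have hξ0 : 0 < ‖ξ‖ := norm_pos_iff.2 fun h => by simp [h] at hξ
  set ε := -fderiv ℝ ρ p ξ / (2 * ‖ξ‖) with hε
  have hεpos : 0 < ε := by apply div_pos <;> linarith
  have hb := hs.bound hεpos
  have ht : Tendsto (fun x : Cd d × ℝ => (x.1 + x.2 • ξ, x.1)) (𝓝 (p, 0)) (𝓝 (p, p)) := by
    have : Continuous (fun x : Cd d × ℝ => (x.1 + x.2 • ξ, x.1)) := by fun_prop
    simpa using this.tendsto (p, 0)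
  have h2 := ht.eventually hb
  rw [nhds_prod_eq] at h2
  obtain ⟨P, hP, Q, hQ, hPQ⟩ := Filter.eventually_prod_iff.1 h2
  obtain ⟨t₀, ht₀, hball⟩ := Metric.eventually_nhds_iff.1 hQ
  refine ⟨t₀ / 2, half_pos ht₀, hP.mono fun q hq t htt => ?_⟩
  have hthis := hPQ hq (hball (y := t) (by
    rw [Real.dist_eq, sub_zero, abs_of_pos htt.1]; linarith [htt.2]))
  simp only [add_sub_cancel_left, map_smul, smul_eq_mul] at hthis
  rw [norm_smul, Real.norm_eq_abs, Real.norm_eq_abs, abs_of_pos htt.1] at hthis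
  have h3 := (abs_le.1 hthis).2
  have h4 : ε * (t * ‖ξ‖) = t * (-fderiv ℝ ρ p ξ / 2) := by rw [hε]; field_simp
  rw [h4] at h3
  nlinarith [htt.1]

/-- At a boundary point, the complex gradients of two defining functions are positively
proportional. -/
lemma exists_complexGradient_eq_smul {ρ' : Cd d → ℝ} (h : IsDefiningFunction D ρ)
    (h' : IsDefiningFunction D ρ') {w : Cd d} (hw : w ∈ frontier D) :
    ∃ c : ℝ, 0 < c ∧ complexGradient ρ' w = (c : ℂ) • complexGradient ρ w := by
  set A := fderiv ℝ ρ w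
  set B := fderiv ℝ ρ' w
  have key : ∀ v, A v < 0 → B v ≤ 0 := by
    intro v hv
    by_contra! hB
    obtain ⟨t, ht, hq⟩ := exists_forall_add_smul_lt h.contDiff hv
    obtain ⟨t', ht', hq'⟩ := exists_forall_add_smul_lt (ρ := fun z => -ρ' z)
      h'.contDiff.neg (p := w) (ξ := v) (by rw [fderiv_fun_neg]; simpa using hB)
    have h1 := hq.self_of_nhds (min t t') ⟨lt_min ht ht', min_le_left _ _⟩
    have h2 := hq'.self_of_nhds (min t t') ⟨lt_min ht ht', min_le_right _ _⟩
    rw [h.eq_zero_of_mem_frontier hw] at h1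
    rw [h'.eq_zero_of_mem_frontier hw] at h2
    have h3 := h'.mem_iff.1 (h.mem_iff.2 h1)
    linarith
  obtain ⟨u, hu⟩ : ∃ u, A u < 0 := by
    have hne : A ≠ 0 := h.fderiv_ne_zero w hw
    obtain ⟨v, hv⟩ : ∃ v, A v ≠ 0 := by
      by_contra! hcon
      exact hne (ContinuousLinearMap.ext hcon)
    rcases lt_or_gt_of_ne hv with h1 | h1
    · exact ⟨v, h1⟩
    · exact ⟨-v, by simpa using h1⟩
  have ker_le : ∀ v, A v = 0 → B v ≤ 0 := by
    intro v hv
    -- `v` is the limit of the strictly decreasing directions `v + t u`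
    by_contra! hB
    have ht : 0 < B v / (2 * (|B u| + 1)) := by positivity
    have h1 := key (v + (B v / (2 * (|B u| + 1))) • u)
      (by simp only [map_add, map_smul, hv, smul_eq_mul, zero_add]
          exact mul_neg_of_pos_of_neg ht hu)
    simp only [map_add, map_smul, smul_eq_mul] at h1
    have h2 : B v / (2 * (|B u| + 1)) * |B u| ≤ B v / 2 := by
      rw [div_mul_eq_mul_div, div_le_div_iff₀ (by positivity) (by norm_num)]
      nlinarith [abs_nonneg (B u)]
    nlinarith [neg_abs_le (B u)]
  have ker_eq : ∀ v, A v = 0 → B v = 0 := fun v hv =>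
    le_antisymm (ker_le v hv) (by simpa using ker_le (-v) (by simp [hv]))
  have hprop : ∀ v, B v = (B u / A u) * A v := by
    intro v
    have h1 := ker_eq (v - (A v / A u) • u) (by simp [hu.ne])
    simp only [map_sub, map_smul, smul_eq_mul] at h1
    field_simp at h1 ⊢
    linarith
  have hc0 : 0 ≤ B u / A u := div_nonneg_of_nonpos (key u hu) hu.le
  have hc : B u / A u ≠ 0 := by
    intro h0
    refine h'.fderiv_ne_zero w hw (ContinuousLinearMap.ext fun v => ?_)
    have := hprop v
    rw [h0, zero_mul] at this
    exact this
  refine ⟨B u / A u, lt_of_le_of_ne hc0 (Ne.symm hc), ?_⟩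
  ext j
  have e1 := hprop (EuclideanSpace.single j (1 : ℂ))
  have e2 := hprop (EuclideanSpace.single j Complex.I)
  simp only [complexGradient, PiLp.smul_apply, smul_eq_mul]
  change ((B _ : ℂ) - Complex.I * (B _ : ℂ)) / 2 = _ * (((A _ : ℂ) - Complex.I * (A _ : ℂ)) / 2)
  rw [e1, e2]
  push_cast
  ring

/-- The tangent functional at a boundary point does not depend on the defining function. -/
lemma tangentFunctional_congr {ρ' : Cd d → ℝ} (h : IsDefiningFunction D ρ)
    (h' : IsDefiningFunction D ρ') (z : Cd d) {w : Cd d} (hw : w ∈ frontier D) :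
    tangentFunctional ρ' z w = tangentFunctional ρ z w := by
  obtain ⟨c, hc, e⟩ := exists_complexGradient_eq_smul h h' hw
  have hn : (‖complexGradient ρ w‖ : ℂ) ≠ 0 := by
    exact_mod_cast norm_ne_zero_iff.2 (h.complexGradient_ne_zero hw)
  have hc' : (c : ℂ) ≠ 0 := by exact_mod_cast hc.ne'
  have e2 : bilinPairing ((c : ℂ) • complexGradient ρ w) (w - z)
      = c * bilinPairing (complexGradient ρ w) (w - z) := by
    simp [bilinPairing, Finset.mul_sum, mul_assoc]
  rw [tangentFunctional, tangentFunctional, e, e2, norm_smul]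
  simp only [Complex.norm_real, Real.norm_eq_abs, abs_of_pos hc, Complex.ofReal_mul]
  field_simp

/-- The polyhedron does not depend on the defining function. -/
lemma inducedPolyhedron_congr {ρ' : Cd d → ℝ} (h : IsDefiningFunction D ρ)
    (h' : IsDefiningFunction D ρ') (φ : Set (frontier D)) (δ : frontier D → ℝ) :
    inducedPolyhedron D ρ' φ δ = inducedPolyhedron D ρ φ δ := by
  have : tubeComplement D ρ' φ δ = tubeComplement D ρ φ δ := by
    ext z
    simp only [tubeComplement, Set.mem_ofPred_eq]
    exact forall₂_congr fun w _ => by rw [tangentFunctional_congr h h' z w.2]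
  simp only [inducedPolyhedron, this]

lemma norm_tangentFunctional (ρ : Cd d → ℝ) (z w : Cd d) :
    ‖tangentFunctional ρ z w‖
      = ‖bilinPairing (complexGradient ρ w) (w - z)‖ / ‖complexGradient ρ w‖ := by
  simp [tangentFunctional]

lemma norm_tangentFunctional_le (ρ : Cd d → ℝ) (z w : Cd d) :
    ‖tangentFunctional ρ z w‖ ≤ ‖w - z‖ := by
  rw [norm_tangentFunctional]
  refine div_le_of_le_mul₀ (norm_nonneg _) (norm_nonneg _) ?_
  rw [mul_comm]
  exact norm_bilinPairing_le _ _

/-- The tangent functional is `1`-Lipschitz in its first argument. -/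
lemma norm_tangentFunctional_le_add (ρ : Cd d → ℝ) (z z' w : Cd d) :
    ‖tangentFunctional ρ z w‖ ≤ ‖tangentFunctional ρ z' w‖ + ‖z' - z‖ := by
  have e : w - z = (w - z') + (z' - z) := by abel
  rw [norm_tangentFunctional, norm_tangentFunctional, e, bilinPairing_add]
  refine (div_le_div_of_nonneg_right (norm_add_le _ _) (norm_nonneg _)).trans ?_
  rw [add_div]
  gcongr
  refine div_le_of_le_mul₀ (norm_nonneg _) (norm_nonneg _) ?_
  rw [mul_comm]
  exact norm_bilinPairing_le _ _

end Boundary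

/-! ### Second-order estimate at the boundary -/

section SecondOrder

variable {d : ℕ} {D : Set (Cd d)} {ρ : Cd d → ℝ}

/-- On a compact set, a function that is positive where a nonnegative function `h` vanishes becomes
positive after adding a large multiple of `h`. -/
lemma exists_le_add_mul_of_isCompact {X : Type*} [TopologicalSpace X] {S : Set X}
    (hS : IsCompact S) {F h : X → ℝ} (hF : Continuous F) (hh : Continuous h) (h0 : ∀ x, 0 ≤ h x)
    (hpos : ∀ x ∈ S, h x = 0 → 0 < F x) :
    ∃ c > 0, ∃ K ≥ 0, ∀ x ∈ S, c ≤ F x + K * h x := by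
  obtain ⟨n, hn⟩ := hS.elim_directed_cover (fun n : ℕ => {x | 0 < F x + n * h x})
    (fun n => isOpen_lt continuous_const (by fun_prop))
    (fun x hx => by
      rw [Set.mem_iUnion]
      rcases (h0 x).eq_or_lt with h1 | h1
      · exact ⟨0, by simpa using hpos x hx h1.symm⟩
      · obtain ⟨n, hn⟩ := exists_nat_gt (-F x / h x)
        refine ⟨n, ?_⟩
        rw [div_lt_iff₀ h1] at hn
        change 0 < F x + n * h x
        linarith)
    (directed_of_isDirected_le fun m n hmn x (hx : 0 < F x + m * h x) => by
      have : (m : ℝ) * h x ≤ n * h x := by gcongr; exact h0 x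
      change 0 < F x + n * h x
      linarith)
  rcases S.eq_empty_or_nonempty with rfl | hne
  · exact ⟨1, one_pos, 0, le_rfl, by simp⟩
  obtain ⟨x, hx, hmin⟩ := hS.exists_isMinOn hne (f := fun x => F x + n * h x) (by fun_prop)
  exact ⟨F x + n * h x, hn hx, n, Nat.cast_nonneg n, fun y hy => hmin hy⟩

/-- Taylor's inequality of order two with a lower bound on the second derivative. -/
lemma add_deriv_add_half_le {h h' h'' : ℝ → ℝ} {m : ℝ} (h1 : ∀ t, HasDerivAt h (h' t) t)
    (h2 : ∀ t, HasDerivAt h' (h'' t) t) (hm : ∀ t ∈ Set.Icc (0 : ℝ) 1, m ≤ h'' t) :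
    h 0 + h' 0 + m / 2 ≤ h 1 := by
  have mono' : MonotoneOn (fun t => h' t - m * t) (Set.Icc 0 1) := by
    refine monotoneOn_of_hasDerivWithinAt_nonneg (convex_Icc 0 1)
      (f' := fun t => h'' t - m * 1)
      (fun t _ => (((h2 t).sub ((hasDerivAt_id t).const_mul m)).continuousAt).continuousWithinAt)
      (fun t _ => ((h2 t).sub ((hasDerivAt_id t).const_mul m)).hasDerivWithinAt) (fun t ht => ?_)
    have := hm t (interior_subset ht)
    linarith
  have hd : ∀ t, HasDerivAt (fun t => h t - (h' 0 * t + m / 2 * t ^ 2))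
      (h' t - (h' 0 * 1 + m / 2 * (2 * t))) t := fun t => by
    have := (h1 t).sub (((hasDerivAt_id t).const_mul (h' 0)).add
      ((hasDerivAt_pow 2 t).const_mul (m / 2)))
    exact this.congr_deriv (by simp)
  have mono : MonotoneOn (fun t => h t - (h' 0 * t + m / 2 * t ^ 2)) (Set.Icc 0 1) := by
    refine monotoneOn_of_hasDerivWithinAt_nonneg (convex_Icc 0 1)
      (fun t _ => (hd t).continuousAt.continuousWithinAt)
      (fun t _ => (hd t).hasDerivWithinAt) (fun t ht => ?_)
    have ht' := interior_subset ht
    have := mono' (Set.left_mem_Icc.2 zero_le_one) ht' ht'.1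
    simp only [mul_zero, sub_zero] at this
    linarith
  have := mono (Set.left_mem_Icc.2 zero_le_one) (Set.right_mem_Icc.2 zero_le_one) zero_le_one
  simp only at this
  linarith

lemma isCompact_frontier (hDb : Bornology.IsBounded D) : IsCompact (frontier D) :=
  Metric.isCompact_of_isClosed_isBounded isClosed_frontier
    (hDb.closure.subset frontier_subset_closure)

/-- Uniform continuity near a compact set. -/
lemma exists_forall_norm_sub_lt {E F : Type*} [SeminormedAddCommGroup E] [SeminormedAddCommGroup F]
    {S : Set E} (hS : IsCompact S) {f : E → F} (hf : Continuous f) {ε : ℝ} (hε : 0 < ε) :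
    ∃ r > 0, ∀ w ∈ S, ∀ v, ‖v‖ < r → ‖f w - f (w + v)‖ < ε := by
  have hunif : ∀ᶠ v in 𝓝 (0 : E), ∀ w ∈ S, ‖f w - f (w + v)‖ < ε := by
    refine hS.eventually_forall_of_forall_eventually fun w _ => ?_
    have hcont : Continuous fun p : E × E => ‖f p.2 - f (p.2 + p.1)‖ := by fun_prop
    refine hcont.continuousAt.eventually_lt continuousAt_const ?_
    simpa using hε
  obtain ⟨r, hr, hrr⟩ := Metric.eventually_nhds_iff.1 hunif
  exact ⟨r, hr, fun w hw v hv => hrr (by simpa using hv) w hw⟩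

/-- Strong `ℂ`-convexity in quantitative form: near the boundary point `w`, the defining function
is bounded below by a square, up to a multiple of the pairing with the complex gradient. -/
lemma exists_sq_le_add_pairing (h : IsDefiningFunction D ρ) (hDb : Bornology.IsBounded D)
    (hH : ∀ w ∈ frontier D, ∀ v ∈ complexTangentSpace ρ w, v ≠ 0 →
      0 < fderiv ℝ (fderiv ℝ ρ) w v v) :
    ∃ r > 0, ∃ c > 0, ∃ K ≥ 0, ∀ w ∈ frontier D, ∀ v : Cd d, ‖v‖ ≤ r →
      c * ‖v‖ ^ 2 ≤ ρ (w + v) + K * ‖bilinPairing (complexGradient ρ w) v‖ := by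
  have hfr := isCompact_frontier hDb
  have c1 : Continuous (complexGradient ρ) := continuous_complexGradient h.contDiff
  have hd1 : ContDiff ℝ 1 (fderiv ℝ ρ) := h.contDiff.fderiv_right (by norm_num)
  have c2 : Continuous (fderiv ℝ (fderiv ℝ ρ)) := hd1.continuous_fderiv (by norm_num)
  have cB : Continuous fun p : Cd d × Cd d => bilinPairing (complexGradient ρ p.1) p.2 :=
    continuous_bilinPairing.comp ((c1.comp continuous_fst).prodMk continuous_snd)
  obtain ⟨c, hc, K, hK, hcK⟩ := exists_le_add_mul_of_isCompact
    (hfr.prod (isCompact_sphere (0 : Cd d) 1))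
    (F := fun p : Cd d × Cd d => fderiv ℝ (fderiv ℝ ρ) p.1 p.2 p.2)
    (h := fun p => ‖bilinPairing (complexGradient ρ p.1) p.2‖)
    (((c2.comp continuous_fst).clm_apply continuous_snd).clm_apply continuous_snd) cB.norm
    (fun _ => norm_nonneg _) (fun p hp h0 => hH p.1 hp.1 p.2 (norm_eq_zero.1 h0)
      (fun hv => by have := hp.2; rw [hv] at this; simp at this))
  obtain ⟨r, hr, hrr⟩ :=
    exists_forall_norm_sub_lt (F := Cd d →L[ℝ] Cd d →L[ℝ] ℝ) hfr c2 (half_pos hc)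
  refine ⟨min (r / 2) 1, lt_min (half_pos hr) one_pos, c / 4, by positivity, 2 + K / 2,
    by positivity,
    fun w hw v hv => ?_⟩
  have hv1 : ‖v‖ ≤ r / 2 := hv.trans (min_le_left _ _)
  have hv2 : ‖v‖ ≤ 1 := hv.trans (min_le_right _ _)
  set b := ‖bilinPairing (complexGradient ρ w) v‖ with hb
  have hess : c * ‖v‖ ^ 2 ≤ fderiv ℝ (fderiv ℝ ρ) w v v + K * (‖v‖ * b) := by
    rcases eq_or_ne v 0 with rfl | hv0
    · simp
    have hn : 0 < ‖v‖ := norm_pos_iff.2 hv0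
    have h1 := hcK (w, (‖v‖⁻¹ : ℝ) • v) ⟨hw, by simp [norm_smul, hn.ne']⟩
    have e : bilinPairing (complexGradient ρ w) ((‖v‖⁻¹ : ℝ) • v)
        = ((‖v‖⁻¹ : ℝ) : ℂ) * bilinPairing (complexGradient ρ w) v := by
      rw [← bilinPairing_smul]; rfl
    simp only [e, map_smul, smul_apply, smul_eq_mul, norm_mul,
      Complex.norm_real, Real.norm_eq_abs, abs_inv, abs_norm] at h1
    rw [← hb] at h1
    have h2 := mul_le_mul_of_nonneg_left h1 (sq_nonneg ‖v‖)
    calc c * ‖v‖ ^ 2 = ‖v‖ ^ 2 * c := by ring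
      _ ≤ _ := h2
      _ = _ := by field_simp
  have hder1 : ∀ t : ℝ, HasDerivAt (fun t : ℝ => ρ (w + t • v)) (fderiv ℝ ρ (w + t • v) v) t :=
    fun t => by
      have hl : HasDerivAt (fun t : ℝ => w + t • v) v t := by
        simpa using ((hasDerivAt_id t).smul_const v).const_add w
      exact (h.hasFDerivAt (w + t • v)).comp_hasDerivAt t hl
  have hder2 : ∀ t : ℝ, HasDerivAt (fun t : ℝ => fderiv ℝ ρ (w + t • v) v)
      (fderiv ℝ (fderiv ℝ ρ) (w + t • v) v v) t := fun t => by
    have hl : HasDerivAt (fun t : ℝ => w + t • v) v t := by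
      simpa using ((hasDerivAt_id t).smul_const v).const_add w
    have h3 := ((hd1.differentiable (by norm_num) (w + t • v)).hasFDerivAt).comp_hasDerivAt t hl
    simpa using h3.clm_apply (hasDerivAt_const t v)
  have hT := add_deriv_add_half_le (m := c / 2 * ‖v‖ ^ 2 - K * (‖v‖ * b)) hder1 hder2
    (fun t ht => by
      have hdist : ‖t • v‖ < r := by
        rw [norm_smul, Real.norm_eq_abs, abs_of_nonneg ht.1]
        nlinarith [ht.2, norm_nonneg v]
      have h4 := hrr w hw _ hdist
      have h5 := (fderiv ℝ (fderiv ℝ ρ) w - fderiv ℝ (fderiv ℝ ρ) (w + t • v)).le_opNorm₂ v v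
      simp only [sub_apply, Real.norm_eq_abs] at h5
      have h6 := (abs_le.1 h5).2
      have h7 : ‖fderiv ℝ (fderiv ℝ ρ) w - fderiv ℝ (fderiv ℝ ρ) (w + t • v)‖ * ‖v‖ * ‖v‖
          ≤ c / 2 * ‖v‖ * ‖v‖ := by gcongr
      nlinarith)
  simp only [zero_smul, add_zero, one_smul] at hT
  rw [h.eq_zero_of_mem_frontier hw, fderiv_eq_two_re] at hT
  have h8 := (abs_le.1 (Complex.abs_re_le_norm (bilinPairing (complexGradient ρ w) v))).1
  rw [← hb] at h8
  have h9 : K * (‖v‖ * b) ≤ K * b := by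
    have : ‖v‖ * b ≤ 1 * b := by gcongr
    rw [one_mul] at this
    gcongr
  linarith

end SecondOrder

/-! ### Complex lines meet the domain in connected sets -/

section Slices

/-- Let `U ⊆ F` be plane sets, `U` open and `F` compact, such that each point of `F \ U` is either
isolated in `F` or has a direction that moves all nearby points of `F` into `U`. Then two points of
`U` that are not joined in `U` are separated by a compact set that avoids `F`. -/
lemma exists_isCompact_separating {U F : Set ℂ} (hU : IsOpen U) (hF : IsCompact F) (hUF : U ⊆ F)
    (hbd : ∀ x ∈ F \ U, (∀ᶠ y in 𝓝[≠] x, y ∉ F) ∨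
      ∃ e : ℂ, ∃ t₀ > (0 : ℝ), ∀ᶠ y in 𝓝 x, y ∈ F → ∀ t ∈ Set.Ioc (0 : ℝ) t₀, y + t • e ∈ U)
    {a b : ℂ} (ha : a ∈ U) (hb : b ∈ U) (hab : ¬ JoinedIn U a b) :
    ∃ S : Set ℂ, IsCompact S ∧ Disjoint S F ∧
      ∀ C : Set ℂ, IsPreconnected C → a ∈ C → b ∈ C → (C ∩ S).Nonempty := by
  set A := connectedComponentIn U a with hA
  have hAU : A ⊆ U := connectedComponentIn_subset U a
  have hAo : IsOpen A := hU.connectedComponentIn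
  have haA : a ∈ A := mem_connectedComponentIn ha
  have hAc : IsPreconnected A := isPreconnected_connectedComponentIn
  have hbA : b ∉ A := fun hbA => hab <|
    (((hAo.isConnected_iff_isPathConnected).1 ⟨⟨a, haA⟩, hAc⟩).joinedIn a haA b hbA).mono hAU
  -- a connected subset of `U` that meets `A` lies in `A`
  have absorb : ∀ C : Set ℂ, IsPreconnected C → C ⊆ U → (C ∩ A).Nonempty → C ⊆ A := by
    rintro C hC hCU ⟨x, hxC, hxA⟩
    rw [hA, connectedComponentIn_eq hxA]
    exact hC.subset_connectedComponentIn hxC hCU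
  set K := closure A with hK
  have hKF : K ⊆ F := closure_minimal (hAU.trans hUF) hF.isClosed
  have hKc : IsCompact K := hF.of_isClosed_subset isClosed_closure hKF
  have hKU : K ∩ U ⊆ A := by
    rintro x ⟨hxK, hxU⟩
    obtain ⟨r, hr, hball⟩ := Metric.isOpen_iff.1 hU x hxU
    obtain ⟨y, hyA, hy⟩ := Metric.mem_closure_iff.1 hxK r hr
    exact absorb _ (convex_ball x r).isPreconnected hball
      ⟨y, by rwa [Metric.mem_ball, dist_comm], hyA⟩ (Metric.mem_ball_self hr)
  -- the closure of the component is open in `F`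
  have hopen : ∀ x ∈ K, ∀ᶠ y in 𝓝 x, y ∈ F → y ∈ K := by
    intro x hxK
    by_cases hxU : x ∈ U
    · filter_upwards [hAo.mem_nhds (hKU ⟨hxK, hxU⟩)] with y hy _ using subset_closure hy
    rcases hbd x ⟨hKF hxK, hxU⟩ with hiso | ⟨e, t₀, ht₀, hev⟩
    · exfalso
      rw [eventually_nhdsWithin_iff] at hiso
      obtain ⟨y, hy, hyA⟩ := mem_closure_iff_nhds.1 hxK _ hiso
      exact hy (fun h => hxU (h ▸ hAU hyA)) (hUF (hAU hyA))
    · have hx0 : x + t₀ • e ∈ U := hev.self_of_nhds (hKF hxK) t₀ ⟨ht₀, le_rfl⟩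
      obtain ⟨r, hr, hball⟩ := Metric.isOpen_iff.1 hU _ hx0
      have hN := hev.and (Metric.ball_mem_nhds x hr)
      obtain ⟨y', ⟨hy', hy'r⟩, hy'A⟩ := mem_closure_iff_nhds.1 hxK _ hN
      have hshift : ∀ y ∈ Metric.ball x r, y + t₀ • e ∈ Metric.ball (x + t₀ • e) r := by
        intro y hy
        simpa [Metric.mem_ball] using hy
      have hray : ∀ y, IsPreconnected ((fun t : ℝ => y + t • e) '' Set.Ioc 0 t₀) := fun y =>
        isPreconnected_Ioc.image _ (by fun_prop)
      have hray' : ∀ y, IsPreconnected ((fun t : ℝ => y + t • e) '' Set.Icc 0 t₀) := fun y =>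
        isPreconnected_Icc.image _ (by fun_prop)
      -- the shifted ball lies in `A`, being connected to `y'` by a segment in direction `e`
      have hB : Metric.ball (x + t₀ • e) r ⊆ A := by
        refine absorb _ (convex_ball _ _).isPreconnected hball ⟨_, hshift y' hy'r, ?_⟩
        refine absorb _ (hray' y') ?_ ⟨y', ⟨0, ⟨le_rfl, ht₀.le⟩, by simp⟩, hy'A⟩
          ⟨t₀, ⟨ht₀.le, le_rfl⟩, rfl⟩
        rintro _ ⟨t, ht, rfl⟩
        rcases ht.1.eq_or_lt with h0 | h0
        · simpa [← h0] using hAU hy'A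
        · exact hy' (hUF (hAU hy'A)) t ⟨h0, ht.2⟩
      filter_upwards [hN] with y hy hyF
      have hyA : (fun t : ℝ => y + t • e) '' Set.Ioc 0 t₀ ⊆ A := by
        refine absorb _ (hray y) ?_ ⟨y + t₀ • e, ⟨t₀, ⟨ht₀, le_rfl⟩, rfl⟩, hB (hshift y hy.2)⟩
        rintro _ ⟨t, ht, rfl⟩
        exact hy.1 hyF t ht
      have hlim : Tendsto (fun t : ℝ => y + t • e) (𝓝[>] 0) (𝓝 y) := by
        have : Continuous fun t : ℝ => y + t • e := by fun_prop
        simpa using (this.tendsto 0).mono_left nhdsWithin_le_nhds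
      refine mem_closure_of_tendsto hlim ?_
      filter_upwards [Ioc_mem_nhdsGT ht₀] with t ht using hyA ⟨t, ht, rfl⟩
  have hFK : IsClosed (F \ K) := by
    rw [← isOpen_compl_iff, isOpen_iff_mem_nhds]
    intro x hx
    by_cases hxK : x ∈ K
    · filter_upwards [hopen x hxK] with y hy hyF using hyF.2 (hy hyF.1)
    · have hxF : x ∉ F := fun hxF => hx ⟨hxF, hxK⟩
      filter_upwards [hF.isClosed.isOpen_compl.mem_nhds hxF] with y hy hyF using hy hyF.1
  have hbK : b ∉ K := fun h => hbA (hKU ⟨h, hb⟩)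
  obtain ⟨δ, hδ, hdisj⟩ := (Set.disjoint_sdiff_right (s := K) (t := F)).exists_thickenings hKc hFK
  have hne : K.Nonempty := ⟨a, subset_closure haA⟩
  have hfar : ∀ x ∈ F \ K, δ ≤ Metric.infDist x K := by
    intro x hx
    by_contra! hlt
    exact Set.disjoint_left.1 hdisj ((Metric.mem_thickening_iff_infDist_lt hne).2 hlt)
      (Metric.self_subset_thickening hδ _ hx)
  refine ⟨{x | Metric.infDist x K = δ / 2}, ?_, ?_, ?_⟩
  · refine Metric.isCompact_of_isClosed_isBounded
      (isClosed_eq (Metric.continuous_infDist_pt K) continuous_const) ?_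
    refine (hKc.isBounded.thickening (δ := δ)).subset fun x hx => ?_
    rw [Metric.mem_thickening_iff_infDist_lt hne, show Metric.infDist x K = δ / 2 from hx]
    linarith
  · rw [Set.disjoint_left]
    intro x (hx : Metric.infDist x K = δ / 2) hxF
    by_cases hxK : x ∈ K
    · rw [Metric.infDist_zero_of_mem hxK] at hx; linarith
    · linarith [hfar x ⟨hxF, hxK⟩]
  · intro C hC haC hbC
    have hmem := hC.intermediate_value haC hbC (Metric.continuous_infDist_pt K).continuousOn
    rw [Metric.infDist_zero_of_mem (subset_closure haA)] at hmem
    obtain ⟨x, hxC, hx⟩ := hmem ⟨(half_pos hδ).le, by linarith [hfar b ⟨hUF hb, hbK⟩]⟩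
    exact ⟨x, hxC, hx⟩

end Slices

section SlicesOfDomain

variable {d : ℕ} {D : Set (Cd d)} {ρ : Cd d → ℝ}

lemma JoinedIn.exists_isPreconnected {X : Type*} [TopologicalSpace X] {S : Set X} {a b : X}
    (h : JoinedIn S a b) : ∃ C ⊆ S, IsCompact C ∧ IsPreconnected C ∧ a ∈ C ∧ b ∈ C :=
  ⟨Set.range h.somePath, by rintro _ ⟨t, rfl⟩; exact h.somePath_mem t,
    isCompact_range h.somePath.continuous, isPreconnected_range h.somePath.continuous,
    ⟨0, h.somePath.source⟩, ⟨1, h.somePath.target⟩⟩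

/-- A tangential complex line leaves `closure D` near the point of tangency. -/
lemma exists_forall_add_notMem_closure (h : IsDefiningFunction D ρ) (hDb : Bornology.IsBounded D)
    (hH : ∀ w ∈ frontier D, ∀ v ∈ complexTangentSpace ρ w, v ≠ 0 →
      0 < fderiv ℝ (fderiv ℝ ρ) w v v) :
    ∃ r > 0, ∀ w ∈ frontier D, ∀ v : Cd d, v ≠ 0 → ‖v‖ ≤ r →
      bilinPairing (complexGradient ρ w) v = 0 → w + v ∉ closure D := by
  obtain ⟨r, hr, c, hc, K, -, hq⟩ := exists_sq_le_add_pairing h hDb hH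
  refine ⟨r, hr, fun w hw v hv hvr h0 hcl => ?_⟩
  have h1 := hq w hw v hvr
  rw [h0, norm_zero, mul_zero, add_zero] at h1
  have h2 := h.nonpos_of_mem_closure hcl
  have : 0 < c * ‖v‖ ^ 2 := by have := norm_pos_iff.2 hv; positivity
  linarith

/-- At a boundary point of `D`, a transversal complex line has a direction that moves all nearby
points of `closure D` into `D`. -/
lemma exists_inward_direction (h : IsDefiningFunction D ρ) {p v : Cd d}
    (hv : bilinPairing (complexGradient ρ p) v ≠ 0) :
    ∃ e : ℂ, ∃ t₀ > (0 : ℝ), ∀ᶠ q in 𝓝 p, q ∈ closure D →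
      ∀ t ∈ Set.Ioc (0 : ℝ) t₀, q + t • (e • v) ∈ D := by
  set b := bilinPairing (complexGradient ρ p) v
  have hneg : fderiv ℝ ρ p ((-(starRingEnd ℂ) b) • v) < 0 := by
    rw [fderiv_eq_two_re, bilinPairing_smul, neg_mul, ← Complex.normSq_eq_conj_mul_self]
    have := Complex.normSq_pos.2 hv
    simpa using this
  obtain ⟨t₀, ht₀, hq⟩ := exists_forall_add_smul_lt h.contDiff hneg
  exact ⟨_, t₀, ht₀, hq.mono fun q hq hqD t ht =>
    h.mem_iff.2 ((hq t ht).trans_le (h.nonpos_of_mem_closure hqD))⟩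

/-- Any two points of `D` are joined inside the complex line through them. The set of such pairs
of points is open and closed in `D × D`: a component of a slice of `D` can be split off only
through a tangency, but at a tangency the slice is an isolated point. -/
theorem joinedIn_slice (h : IsDefiningFunction D ρ) (hDb : Bornology.IsBounded D)
    (hD : IsConnected D)
    (hH : ∀ w ∈ frontier D, ∀ v ∈ complexTangentSpace ρ w, v ≠ 0 →
      0 < fderiv ℝ (fderiv ℝ ρ) w v v) {z z' : Cd d} (hz : z ∈ D) (hz' : z' ∈ D) :
    JoinedIn {l : ℂ | z + l • (z' - z) ∈ D} 0 1 := by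
  have hDo := h.isOpen
  set J : Cd d × Cd d → Prop := fun p => JoinedIn {l : ℂ | p.1 + l • (p.2 - p.1) ∈ D} 0 1 with hJ
  have hev : Continuous fun q : (Cd d × Cd d) × ℂ => q.1.1 + q.2 • (q.1.2 - q.1.1) := by fun_prop
  have hopen : IsOpen {p | p ∈ D ×ˢ D ∧ J p} := by
    rw [isOpen_iff_mem_nhds]
    rintro p ⟨hpD, hp⟩
    obtain ⟨γ, hγ⟩ := hp
    have h1 : ∀ᶠ q in 𝓝 p, ∀ l ∈ Set.range γ, q.1 + l • (q.2 - q.1) ∈ D := by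
      refine (isCompact_range γ.continuous).eventually_forall_of_forall_eventually ?_
      rintro _ ⟨t, rfl⟩
      exact hev.continuousAt.eventually (hDo.mem_nhds (hγ t))
    filter_upwards [h1, (hDo.prod hDo).mem_nhds hpD] with q hq hqD
    exact ⟨hqD, γ, fun t => hq _ ⟨t, rfl⟩⟩
  have hclosed : IsOpen {p | p ∈ D ×ˢ D ∧ ¬ J p} := by
    rw [isOpen_iff_mem_nhds]
    rintro ⟨a, b⟩ ⟨hpD, hp⟩
    have hab : b - a ≠ 0 := by
      intro h0
      apply hp
      have : {l : ℂ | a + l • (b - a) ∈ D} = Set.univ := by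
        ext l; simpa [h0] using hpD.1
      simp only [hJ, this]
      exact isPathConnected_univ.joinedIn 0 trivial 1 trivial
    have hline : Continuous fun l : ℂ => a + l • (b - a) := by fun_prop
    obtain ⟨S, hSc, hSF, hS⟩ := exists_isCompact_separating
      (U := {l : ℂ | a + l • (b - a) ∈ D}) (F := {l : ℂ | a + l • (b - a) ∈ closure D})
      (a := 0) (b := 1)
      (hDo.preimage hline)
      (by
        refine Metric.isCompact_of_isClosed_isBounded (isClosed_closure.preimage hline) ?_
        obtain ⟨R, hR⟩ := hDb.closure.exists_norm_le
        refine isBounded_iff_forall_norm_le.2 ⟨(R + ‖a‖) / ‖b - a‖, fun l hl => ?_⟩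
        have h1 := hR _ hl
        rw [le_div_iff₀ (norm_pos_iff.2 hab), ← norm_smul]
        calc ‖l • (b - a)‖ = ‖(a + l • (b - a)) - a‖ := by rw [add_sub_cancel_left]
          _ ≤ ‖a + l • (b - a)‖ + ‖a‖ := norm_sub_le _ _
          _ ≤ R + ‖a‖ := by gcongr)
      (fun l hl => subset_closure hl)
      (by
        rintro x ⟨hxF, hxU⟩
        have hfr : a + x • (b - a) ∈ frontier D := by
          rw [hDo.frontier_eq]; exact ⟨hxF, hxU⟩
        by_cases h0 : bilinPairing (complexGradient ρ (a + x • (b - a))) (b - a) = 0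
        · left
          obtain ⟨r, hr, hout⟩ := exists_forall_add_notMem_closure h hDb hH
          have hsmall : ∀ᶠ y in 𝓝 x, ‖(y - x) • (b - a)‖ < r := by
            have hc : Continuous fun y : ℂ => ‖(y - x) • (b - a)‖ := by fun_prop
            refine hc.continuousAt.eventually_lt continuousAt_const ?_
            simpa using hr
          filter_upwards [nhdsWithin_le_nhds hsmall, self_mem_nhdsWithin] with y hy hyx hyF
          refine hout _ hfr ((y - x) • (b - a)) (smul_ne_zero (sub_ne_zero.2 hyx) hab) hy.le
            (by rw [bilinPairing_smul, h0, mul_zero]) ?_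
          have e : a + x • (b - a) + (y - x) • (b - a) = a + y • (b - a) := by
            rw [sub_smul]; abel
          rw [e]; exact hyF
        · right
          obtain ⟨e, t₀, ht₀, hq⟩ := exists_inward_direction h h0
          refine ⟨e, t₀, ht₀, (hline.continuousAt.eventually hq).mono fun y hy hyF t ht => ?_⟩
          have := hy hyF t ht
          have e2 : a + (y + t • e) • (b - a) = a + y • (b - a) + t • (e • (b - a)) := by
            rw [add_smul, smul_assoc]; abel
          change a + (y + t • e) • (b - a) ∈ D
          rwa [e2])
      (by simpa using hpD.1) (by simpa using hpD.2) hp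
    have h1 : ∀ᶠ q in 𝓝 (a, b), ∀ l ∈ S, q.1 + l • (q.2 - q.1) ∉ closure D := by
      refine hSc.eventually_forall_of_forall_eventually fun l hl => ?_
      have hx : a + l • (b - a) ∈ (closure D)ᶜ := Set.disjoint_left.1 hSF hl
      exact hev.continuousAt.eventually (isClosed_closure.isOpen_compl.mem_nhds hx)
    filter_upwards [h1, (hDo.prod hDo).mem_nhds hpD] with q hq hqD
    refine ⟨hqD, fun hqJ => ?_⟩
    obtain ⟨C, hCU, -, hC, h0, h1⟩ := hqJ.exists_isPreconnected
    obtain ⟨l, hlC, hlS⟩ := hS C hC h0 h1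
    exact hq l hlS (subset_closure (hCU hlC))
  have hzz : (z, z) ∈ {p | p ∈ D ×ˢ D ∧ J p} := by
    have : {l : ℂ | z + l • (z - z) ∈ D} = Set.univ := by
      ext l; simpa using hz
    refine ⟨⟨hz, hz⟩, ?_⟩
    simp only [hJ, this]
    exact isPathConnected_univ.joinedIn 0 trivial 1 trivial
  have hsub := (hD.isPreconnected.prod hD.isPreconnected).subset_left_of_subset_union hopen hclosed
    (Set.disjoint_left.2 fun p hp hp' => hp'.2 hp.2)
    (fun p hp => by
      by_cases hJp : J p
      · exact Or.inl ⟨hp, hJp⟩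
      · exact Or.inr ⟨hp, hJp⟩)
    ⟨(z, z), Set.mk_mem_prod hz hz, hzz⟩
  have hmem : (z, z') ∈ {p | p ∈ D ×ˢ D ∧ J p} := hsub ⟨hz, hz'⟩
  exact hmem.2

/-- The complex tangent hyperplane at a boundary point touches `closure D` only at that point.
Otherwise, pushing the line through the two common points into `D` gives a complex line whose
slice is disconnected by a small circle around the point of tangency. -/
theorem eq_of_mem_closure_of_pairing_eq_zero (h : IsDefiningFunction D ρ)
    (hDb : Bornology.IsBounded D) (hD : IsConnected D)
    (hH : ∀ w ∈ frontier D, ∀ v ∈ complexTangentSpace ρ w, v ≠ 0 →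
      0 < fderiv ℝ (fderiv ℝ ρ) w v v) {w p : Cd d} (hw : w ∈ frontier D) (hp : p ∈ closure D)
    (h0 : bilinPairing (complexGradient ρ w) (p - w) = 0) : p = w := by
  by_contra hne
  obtain ⟨r, hr, hout⟩ := exists_forall_add_notMem_closure h hDb hH
  have hv : p - w ≠ 0 := sub_ne_zero.2 hne
  have hv' : 0 < ‖p - w‖ := norm_pos_iff.2 hv
  set R := min (r / ‖p - w‖) (1 / 2) with hR
  have hRpos : 0 < R := lt_min (by positivity) (by norm_num)
  have hev : Continuous fun q : (Cd d × Cd d) × ℂ => q.1.1 + q.2 • (q.1.2 - q.1.1) := by fun_prop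
  have h1 : ∀ᶠ q in 𝓝 (w, p), ∀ l ∈ Metric.sphere (0 : ℂ) R,
      q.1 + l • (q.2 - q.1) ∉ closure D := by
    refine (isCompact_sphere _ _).eventually_forall_of_forall_eventually fun l hl => ?_
    refine hev.continuousAt.eventually (isClosed_closure.isOpen_compl.mem_nhds ?_)
    have hl' : ‖l‖ = R := by simpa using hl
    refine hout w hw (l • (p - w)) (smul_ne_zero ?_ hv) ?_ (by rw [bilinPairing_smul, h0, mul_zero])
    · rw [← norm_pos_iff, hl']; exact hRpos
    · rw [norm_smul, hl', ← le_div_iff₀ hv']; exact min_le_left _ _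
  have hmem : (w, p) ∈ closure (D ×ˢ D) := by
    rw [closure_prod_eq]; exact ⟨frontier_subset_closure hw, hp⟩
  obtain ⟨q, hq, hqD⟩ := mem_closure_iff_nhds.1 hmem _ h1
  obtain ⟨C, hCU, -, hC, hC0, hC1⟩ :=
    (joinedIn_slice h hDb hD hH hqD.1 hqD.2).exists_isPreconnected
  obtain ⟨l, hlC, hl⟩ := hC.intermediate_value hC0 hC1 (f := fun l : ℂ => ‖l‖)
    continuous_norm.continuousOn
    (show R ∈ Set.Icc ‖(0 : ℂ)‖ ‖(1 : ℂ)‖ by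
      simp only [norm_zero, norm_one]
      exact ⟨hRpos.le, (min_le_right _ _).trans (by norm_num)⟩)
  exact hq l (by simpa using hl) (subset_closure (hCU hlC))

/-- On the boundary, the tangent functional is bounded below by the squared distance. -/
theorem exists_sq_le_norm_tangentFunctional (h : IsDefiningFunction D ρ)
    (hDb : Bornology.IsBounded D) (hD : IsConnected D)
    (hH : ∀ w ∈ frontier D, ∀ v ∈ complexTangentSpace ρ w, v ≠ 0 →
      0 < fderiv ℝ (fderiv ℝ ρ) w v v) :
    ∃ c > 0, ∀ z ∈ frontier D, ∀ w ∈ frontier D, c * ‖w - z‖ ^ 2 ≤ ‖tangentFunctional ρ z w‖ := by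
  have hfr := isCompact_frontier hDb
  have cG := continuous_complexGradient h.contDiff
  obtain ⟨r, hr, c, hc, K, hK, hq⟩ := exists_sq_le_add_pairing h hDb hH
  obtain ⟨M, hM⟩ := hfr.exists_bound_of_continuousOn (f := complexGradient ρ) cG.continuousOn
  have hM1 : 0 < max M 1 := lt_max_of_lt_right one_pos
  have hpair : ∀ z ∈ frontier D, ∀ w ∈ frontier D,
      ‖bilinPairing (complexGradient ρ w) (z - w)‖ ≤ max M 1 * ‖tangentFunctional ρ z w‖ := by
    intro z _ w hw
    have hn : 0 < ‖complexGradient ρ w‖ := norm_pos_iff.2 (h.complexGradient_ne_zero hw)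
    rw [norm_tangentFunctional, ← neg_sub w z, bilinPairing_neg, norm_neg, mul_div_assoc',
      le_div_iff₀ hn, mul_comm]
    gcongr
    exact (hM w hw).trans (le_max_left _ _)
  have hloc : ∀ z ∈ frontier D, ∀ w ∈ frontier D, ‖w - z‖ ≤ r →
      c / ((K + 1) * max M 1) * ‖w - z‖ ^ 2 ≤ ‖tangentFunctional ρ z w‖ := by
    intro z hz w hw hzw
    have h1 := hq w hw (z - w) (by rwa [norm_sub_rev])
    rw [add_sub_cancel, h.eq_zero_of_mem_frontier hz, zero_add, norm_sub_rev] at h1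
    rw [div_mul_eq_mul_div, div_le_iff₀ (by positivity)]
    have h2 := hpair z hz w hw
    calc _ ≤ _ := h1
      _ ≤ (K + 1) * ‖bilinPairing (complexGradient ρ w) (z - w)‖ := by
        gcongr; linarith
      _ ≤ (K + 1) * (max M 1 * ‖tangentFunctional ρ z w‖) := by gcongr
      _ = _ := by ring
  -- far from the diagonal, the pairing does not vanish and compactness applies
  obtain ⟨κ, hκ, hfar⟩ : ∃ κ > 0, ∀ z ∈ frontier D, ∀ w ∈ frontier D, r ≤ ‖w - z‖ →
      κ * ‖w - z‖ ^ 2 ≤ ‖bilinPairing (complexGradient ρ w) (z - w)‖ := by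
    set T := (frontier D ×ˢ frontier D) ∩ {p : Cd d × Cd d | r ≤ ‖p.2 - p.1‖} with hT
    have hTc : IsCompact T := (hfr.prod hfr).inter_right
      (isClosed_le continuous_const (by fun_prop))
    rcases T.eq_empty_or_nonempty with he | hne
    · exact ⟨1, one_pos, fun z hz w hw hr' =>
        absurd (show (z, w) ∈ T from ⟨⟨hz, hw⟩, hr'⟩) (by simp [he])⟩
    have hcont : ContinuousOn (fun p : Cd d × Cd d =>
        ‖bilinPairing (complexGradient ρ p.2) (p.1 - p.2)‖ / ‖p.2 - p.1‖ ^ 2) T := by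
      refine ContinuousOn.div ?_ (by fun_prop) fun p hp => ?_
      · exact (continuous_bilinPairing.comp ((cG.comp continuous_snd).prodMk
          (continuous_fst.sub continuous_snd))).norm.continuousOn
      · have : 0 < ‖p.2 - p.1‖ := hr.trans_le hp.2
        positivity
    obtain ⟨p, hp, hmin⟩ := hTc.exists_isMinOn hne hcont
    have hp2 : 0 < ‖p.2 - p.1‖ := hr.trans_le hp.2
    refine ⟨‖bilinPairing (complexGradient ρ p.2) (p.1 - p.2)‖ / ‖p.2 - p.1‖ ^ 2, ?_, ?_⟩
    · refine div_pos (norm_pos_iff.2 fun h0 => ?_) (by positivity)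
      have := eq_of_mem_closure_of_pairing_eq_zero h hDb hD hH hp.1.2
        (frontier_subset_closure hp.1.1) h0
      rw [this, sub_self, norm_zero] at hp2
      exact hp2.false
    · intro z hz w hw hzw
      have h1 := hmin (show (z, w) ∈ T from ⟨⟨hz, hw⟩, hzw⟩)
      have : 0 < ‖w - z‖ := hr.trans_le hzw
      exact (le_div_iff₀ (by positivity)).1 h1
  refine ⟨min (c / ((K + 1) * max M 1)) (κ / max M 1), lt_min (by positivity) (by positivity),
    fun z hz w hw => ?_⟩
  rcases le_total ‖w - z‖ r with h1 | h1
  · refine le_trans ?_ (hloc z hz w hw h1)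
    gcongr
    exact min_le_left _ _
  · calc _ ≤ κ / max M 1 * ‖w - z‖ ^ 2 := by gcongr; exact min_le_right _ _
      _ = κ * ‖w - z‖ ^ 2 / max M 1 := by ring
      _ ≤ max M 1 * ‖tangentFunctional ρ z w‖ / max M 1 := by
        exact div_le_div_of_nonneg_right ((hfar z hz w hw h1).trans (hpair z hz w hw)) hM1.le
      _ = _ := by field_simp

end SlicesOfDomain

/-! ### Real coordinates adapted to the complex tangent space -/

section Coordinates

variable {e : ℕ}

/-- The real coordinates of a vector of `ℂ^(e+1)` other than the real part of its first entry; the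
index `none` stands for the imaginary part of the first entry. -/
def realCoords (v : Cd (e + 1)) : Option (Fin e × Bool) → ℝ
  | none => (v 0).im
  | some (j, b) => cond b (v j.succ).re (v j.succ).im

/-- The vector with given real coordinates, `t` being the real part of its first entry. -/
def ofRealCoords (t : ℝ) (x : Option (Fin e × Bool) → ℝ) : Cd (e + 1) :=
  WithLp.toLp 2 (Fin.cons ⟨t, x none⟩ fun j => ⟨x (some (j, true)), x (some (j, false))⟩)

lemma realCoords_ofRealCoords (t : ℝ) (x : Option (Fin e × Bool) → ℝ) :
    realCoords (ofRealCoords t x) = x := by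
  ext (_ | ⟨j, _ | _⟩) <;> simp [realCoords, ofRealCoords]

lemma ofRealCoords_zero (t : ℝ) (x : Option (Fin e × Bool) → ℝ) :
    ofRealCoords t x 0 = ⟨t, x none⟩ := by
  simp [ofRealCoords]

lemma realCoords_sub (v w : Cd (e + 1)) : realCoords (v - w) = realCoords v - realCoords w := by
  ext (_ | ⟨j, _ | _⟩) <;> simp [realCoords]

lemma norm_realCoords_le (v : Cd (e + 1)) : ‖realCoords v‖ ≤ ‖v‖ := by
  refine (pi_norm_le_iff_of_nonneg (norm_nonneg _)).2 ?_
  rintro (_ | ⟨j, _ | _⟩)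
  · exact (Complex.abs_im_le_norm _).trans (PiLp.norm_apply_le v 0)
  · exact (Complex.abs_im_le_norm _).trans (PiLp.norm_apply_le v j.succ)
  · exact (Complex.abs_re_le_norm _).trans (PiLp.norm_apply_le v j.succ)

lemma norm_sq_eq_re_add_sum (v : Cd (e + 1)) :
    ‖v‖ ^ 2 = (v 0).re ^ 2 + ∑ i, realCoords v i ^ 2 := by
  rw [EuclideanSpace.norm_sq_eq, Fin.sum_univ_succ, Fintype.sum_option, Fintype.sum_prod_type]
  simp only [Fintype.univ_bool, Complex.sq_norm, Complex.normSq_apply, realCoords]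
  rw [← add_assoc]
  congr 1
  · ring
  · refine Finset.sum_congr rfl fun j _ => ?_
    simp
    ring

lemma card_option_prod_bool : Fintype.card (Option (Fin e × Bool)) = 2 * e + 1 := by
  simp; ring

lemma norm_sq_le_re_add_norm (v : Cd (e + 1)) :
    ‖v‖ ^ 2 ≤ (v 0).re ^ 2 + (2 * e + 1) * ‖realCoords v‖ ^ 2 := by
  rw [norm_sq_eq_re_add_sum]
  gcongr
  calc ∑ i, realCoords v i ^ 2 ≤ ∑ _i : Option (Fin e × Bool), ‖realCoords v‖ ^ 2 := by
        refine Finset.sum_le_sum fun i _ => ?_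
        rw [← sq_abs]
        gcongr
        exact norm_le_pi_norm (realCoords v) i
    _ = _ := by
        rw [Finset.sum_const, Finset.card_univ, card_option_prod_bool, nsmul_eq_mul]
        push_cast
        ring

/-- A box in the real coordinates. -/
def coordBox (e : ℕ) (A B : ℝ) : Set (Option (Fin e × Bool) → ℝ) :=
  {x | |x none| ≤ A ∧ ∀ p, |x (some p)| ≤ B}

lemma volume_coordBox {A B : ℝ} (hA : 0 ≤ A) (hB : 0 ≤ B) :
    volume (coordBox e A B) = ENNReal.ofReal (2 * A * (2 * B) ^ (2 * e)) := by
  have h : coordBox e A B = Set.pi Set.univ fun i : Option (Fin e × Bool) =>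
      i.elim (Set.Icc (-A) A) fun _ => Set.Icc (-B) B := by
    ext x
    simp only [coordBox, Set.mem_ofPred_eq, Set.mem_univ_pi]
    constructor
    · rintro ⟨h1, h2⟩ (_ | p)
      · exact abs_le.1 h1
      · exact abs_le.1 (h2 p)
    · intro h
      exact ⟨abs_le.2 (h none), fun p => abs_le.2 (h (some p))⟩
  rw [h, volume_pi_pi, Fintype.prod_option]
  simp only [Option.elim, Real.volume_Icc, Finset.prod_const, Finset.card_univ]
  rw [ENNReal.ofReal_mul (by positivity), ENNReal.ofReal_pow (by positivity)]
  congr 2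
  · ring
  · ring_nf
  · simp; ring

/-- A complex isometry that takes the normalized pairing with `a` to the first coordinate. -/
lemma exists_isometry_apply_zero {a : Cd (e + 1)} (ha : a ≠ 0) :
    ∃ U : Cd (e + 1) ≃ₗᵢ[ℂ] Cd (e + 1), ∀ v, U v 0 = bilinPairing a v / ‖a‖ := by
  have hn : (‖a‖ : ℂ) ≠ 0 := by exact_mod_cast norm_ne_zero_iff.2 ha
  set u : Cd (e + 1) := WithLp.toLp 2 fun j => (starRingEnd ℂ) (a j) / ‖a‖ with hu
  have hinner : ∀ v, inner ℂ u v = bilinPairing a v / ‖a‖ := by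
    intro v
    simp only [hu, bilinPairing, PiLp.inner_apply, Finset.sum_div]
    refine Finset.sum_congr rfl fun j _ => ?_
    simp [div_eq_mul_inv]
    ring
  have hunit : ‖u‖ = 1 := by
    have h1 : ‖u‖ ^ 2 = 1 := by
      rw [EuclideanSpace.norm_sq_eq]
      simp only [hu, norm_div, RCLike.norm_conj, Complex.norm_real, norm_norm, div_pow,
        ← Finset.sum_div]
      rw [← EuclideanSpace.norm_sq_eq, div_self]
      exact pow_ne_zero _ (norm_ne_zero_iff.2 ha)
    exact (pow_eq_one_iff_of_nonneg (norm_nonneg _) two_ne_zero).1 h1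
  obtain ⟨b, hb⟩ := Orthonormal.exists_orthonormalBasis_extension_of_card_eq (𝕜 := ℂ)
    (E := Cd (e + 1)) (ι := Fin (e + 1)) (by simp) (v := fun _ => u) (s := {0})
    ⟨fun _ => hunit, fun i j hij => absurd (Subsingleton.elim i j) hij⟩
  exact ⟨b.repr, fun v => by rw [b.repr_apply_apply, hb 0 rfl, hinner]⟩

end Coordinates

/-! ### Comparison of Hausdorff measure and Lebesgue measure -/

section Hausdorff

variable {X ι : Type*} [EMetricSpace X] [MeasurableSpace X] [BorelSpace X] [Fintype ι]

/-- The normalizing factor of the Euclidean Hausdorff measure. -/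
noncomputable abbrev euclideanFactor (n : ℕ) : ℝ≥0 :=
  Measure.addHaarScalarFactor (volume : Measure (EuclideanSpace ℝ (Fin n))) μH[n]

lemma euclideanHausdorffMeasure_le_of_antilipschitz {S : Set X} {f : X → ι → ℝ} {K : ℝ≥0}
    (hf : ∀ x ∈ S, ∀ y ∈ S, edist x y ≤ K * edist (f x) (f y)) :
    μHE[Fintype.card ι] S ≤ euclideanFactor (Fintype.card ι) *
      (K ^ Fintype.card ι * volume (f '' S)) := by
  have hanti : AntilipschitzWith K (fun x : S => f x) := fun x y => hf x x.2 y y.2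
  have h1 := hanti.le_hausdorffMeasure_image (d := Fintype.card ι) (Nat.cast_nonneg _) Set.univ
  rw [← isometry_subtype_coe.hausdorffMeasure_image (Or.inl (Nat.cast_nonneg _)),
    hausdorffMeasure_pi_real] at h1
  rw [Measure.euclideanHausdorffMeasure_def, Measure.smul_apply, ENNReal.smul_def, smul_eq_mul]
  gcongr
  simpa [Set.image_image, ← Set.image_eq_range] using h1

lemma le_euclideanHausdorffMeasure_of_lipschitz {S : Set X} {f : X → ι → ℝ}
    (hf : LipschitzOnWith 1 f S) :
    euclideanFactor (Fintype.card ι) * volume (f '' S) ≤ μHE[Fintype.card ι] S := by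
  have h1 := hf.hausdorffMeasure_image_le (d := Fintype.card ι) (Nat.cast_nonneg _)
  rw [hausdorffMeasure_pi_real] at h1
  rw [Measure.euclideanHausdorffMeasure_def, Measure.smul_apply, ENNReal.smul_def, smul_eq_mul]
  gcongr
  simpa using h1

end Hausdorff

/-! ### Surface area of boundary caps -/

section Caps

lemma IsPreconnected.subset_of_disjoint_frontier {X : Type*} [TopologicalSpace X] {S D : Set X}
    (hS : IsPreconnected S) (hD : IsOpen D) (hne : (S ∩ D).Nonempty)
    (hdisj : Disjoint S (frontier D)) : S ⊆ D := by
  refine hS.subset_left_of_subset_union hD isClosed_closure.isOpen_compl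
    (disjoint_compl_right.mono_left subset_closure) (fun x hx => ?_) hne
  by_contra hcon
  simp only [Set.mem_union, Set.mem_compl_iff, not_or, not_not] at hcon
  refine Set.disjoint_left.1 hdisj hx ?_
  rw [hD.frontier_eq]
  exact ⟨hcon.2, hcon.1⟩

/-- Uniform constants of a defining function near the boundary: bounds of the complex gradient and
a Lipschitz constant of the differential. -/
lemma exists_boundary_constants {d : ℕ} {D : Set (Cd d)} {ρ : Cd d → ℝ}
    (h : IsDefiningFunction D ρ) (hDb : Bornology.IsBounded D) :
    ∃ m > 0, ∃ M > 0, ∃ Λ ≥ 0, (∀ w ∈ frontier D, m ≤ ‖complexGradient ρ w‖) ∧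
      (∀ w ∈ frontier D, ‖complexGradient ρ w‖ ≤ M) ∧
      ∀ z ∈ frontier D, ∀ v : Cd d, ‖v‖ ≤ 1 → ‖fderiv ℝ ρ (z + v) - fderiv ℝ ρ z‖ ≤ Λ * ‖v‖ := by
  have hfr := isCompact_frontier hDb
  have cG := continuous_complexGradient h.contDiff
  obtain ⟨m, hm, hmb⟩ : ∃ m > 0, ∀ w ∈ frontier D, m ≤ ‖complexGradient ρ w‖ := by
    rcases (frontier D).eq_empty_or_nonempty with he | hne
    · exact ⟨1, one_pos, by simp [he]⟩
    obtain ⟨w, hw, hmin⟩ := hfr.exists_isMinOn hne cG.norm.continuousOn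
    exact ⟨_, norm_pos_iff.2 (h.complexGradient_ne_zero hw), fun w' hw' => hmin hw'⟩
  obtain ⟨M, hM⟩ := hfr.exists_bound_of_continuousOn (f := complexGradient ρ) cG.continuousOn
  obtain ⟨R, hR⟩ := hfr.isBounded.exists_norm_le
  have hlip : LocallyLipschitz (fderiv ℝ ρ) :=
    (h.contDiff.fderiv_right (m := 1) (by norm_num)).locallyLipschitz
  obtain ⟨Λ, hΛ⟩ := (hlip.locallyLipschitzOn (s := Metric.closedBall (0 : Cd d) (R + 1))
    ).exists_lipschitzOnWith_of_compact (isCompact_closedBall _ _)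
  refine ⟨m, hm, max M 1, lt_max_of_lt_right one_pos, Λ, Λ.2, hmb,
    fun w hw => (hM w hw).trans (le_max_left _ _), fun z hz v hv => ?_⟩
  have h1 := hΛ.norm_sub_le (x := z + v) (y := z)
    (by rw [mem_closedBall_zero_iff]; exact (norm_add_le _ _).trans (add_le_add (hR z hz) hv))
    (by rw [mem_closedBall_zero_iff]; linarith [hR z hz])
  rwa [add_sub_cancel_left] at h1

/-- First-order Taylor estimate near a boundary point. -/
lemma abs_sub_sub_fderiv_le {d : ℕ} {D : Set (Cd d)} {ρ : Cd d → ℝ} (h : IsDefiningFunction D ρ)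
    {Λ : ℝ} (hΛ0 : 0 ≤ Λ) {z : Cd d}
    (hΛ : ∀ v : Cd d, ‖v‖ ≤ 1 → ‖fderiv ℝ ρ (z + v) - fderiv ℝ ρ z‖ ≤ Λ * ‖v‖)
    {r : ℝ} (hr : r ≤ 1) {x y : Cd d} (hx : ‖x - z‖ ≤ r) (hy : ‖y - z‖ ≤ r) :
    |ρ y - ρ x - fderiv ℝ ρ z (y - x)| ≤ Λ * r * ‖y - x‖ := by
  refine (convex_closedBall z r).norm_image_sub_le_of_norm_hasFDerivWithin_le' (𝕜 := ℝ)
    (f' := fderiv ℝ ρ) (fun p _ => (h.hasFDerivAt p).hasFDerivWithinAt) (fun p hp => ?_)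
    (by rwa [mem_closedBall_iff_norm]) (by rwa [mem_closedBall_iff_norm])
  rw [mem_closedBall_iff_norm] at hp
  have h1 := hΛ (p - z) (hp.trans hr)
  rw [add_sub_cancel] at h1
  exact h1.trans (by gcongr)

lemma continuous_ofRealCoords {e : ℕ} (x : Option (Fin e × Bool) → ℝ) :
    Continuous fun t => ofRealCoords t x := by
  unfold ofRealCoords
  refine (PiLp.continuous_toLp 2 _).comp (continuous_pi fun i => ?_)
  refine Fin.cases ?_ (fun j => ?_) i
  · simp only [Fin.cons_zero, Complex.mk_eq_add_mul_I]
    fun_prop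
  · simp only [Fin.cons_succ]
    exact continuous_const

lemma surfaceMeasure_eq {e : ℕ} (D : Set (Cd (e + 1))) :
    surfaceMeasure D = μHE[2 * e + 1] := rfl

/-- The cap cut off by the tube of size `s` around the point `z` has surface area `O(s^d)`: it is
contained in a ball of radius `O(√s)`, and its extent in the one real tangential direction that is
not complex tangential is `O(s)`. -/
theorem exists_surfaceMeasure_le {e : ℕ} {D : Set (Cd (e + 1))} {ρ : Cd (e + 1) → ℝ}
    (h : IsDefiningFunction D ρ) (hDb : Bornology.IsBounded D) (hD : IsConnected D)
    (hH : ∀ w ∈ frontier D, ∀ v ∈ complexTangentSpace ρ w, v ≠ 0 →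
      0 < fderiv ℝ (fderiv ℝ ρ) w v v) :
    ∃ C > 0, ∃ s₀ > 0, ∀ z ∈ frontier D, ∀ s, 0 < s → s ≤ s₀ →
      surfaceMeasure D {w | ‖tangentFunctional ρ z w‖ ≤ s} ≤ ENNReal.ofReal (C * s ^ (e + 1)) := by
  obtain ⟨m, hm, M, hM, Λ, hΛ0, hmb, hMb, hΛ⟩ := exists_boundary_constants h hDb
  obtain ⟨c, hc, hcb⟩ := exists_sq_le_norm_tangentFunctional h hDb hD hH
  set r := min 1 (m / (Λ + 1)) with hr
  have hrpos : 0 < r := lt_min one_pos (by positivity)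
  set K₁ := (M + Λ / c) / m with hK₁
  have hK₁pos : 0 < K₁ := by positivity
  set K : ℝ≥0 := 2 * (2 * e + 1) with hK
  set κ := euclideanFactor (2 * e + 1)
  refine ⟨κ * K ^ (2 * e + 1) * (2 * K₁ * (4 / c) ^ e) + 1, by positivity, c * r ^ 2, by positivity,
    fun z hz s hs hss => ?_⟩
  have hG := h.complexGradient_ne_zero hz
  have hGm := hmb z hz
  have hGpos : 0 < ‖complexGradient ρ z‖ := hm.trans_le hGm
  obtain ⟨U, hU⟩ := exists_isometry_apply_zero hG
  set A : Set (frontier D) := {w | ‖tangentFunctional ρ z w‖ ≤ s} with hA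
  set f : frontier D → Option (Fin e × Bool) → ℝ := fun w => realCoords (U (w - z)) with hf
  have hdist : ∀ w ∈ A, ‖(w : Cd (e + 1)) - z‖ ^ 2 ≤ s / c := by
    intro w (hw : ‖tangentFunctional ρ z w‖ ≤ s)
    rw [le_div_iff₀ hc, mul_comm]
    exact (hcb z hz w w.2).trans hw
  have hdist' : ∀ w ∈ A, ‖(w : Cd (e + 1)) - z‖ ≤ r := by
    intro w hw
    refine (pow_le_pow_iff_left₀ (norm_nonneg _) hrpos.le two_ne_zero).1 ((hdist w hw).trans ?_)
    rw [div_le_iff₀ hc]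
    linarith
  have himage : f '' A ⊆ coordBox e (K₁ * s) (√(s / c)) := by
    rintro _ ⟨w, hw, rfl⟩
    have hn : ‖(w : Cd (e + 1)) - z‖ ≤ √(s / c) := Real.le_sqrt_of_sq_le (hdist w hw)
    constructor
    · have h1 : ‖bilinPairing (complexGradient ρ w) ((w : Cd (e + 1)) - z)‖ ≤ M * s := by
        have hw' : ‖tangentFunctional ρ z w‖ ≤ s := hw
        rw [norm_tangentFunctional, div_le_iff₀ (hm.trans_le (hmb w w.2)), mul_comm] at hw'
        exact hw'.trans (by gcongr; exact hMb w w.2)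
      have h2 := norm_bilinPairing_sub_le ρ z w ((w : Cd (e + 1)) - z)
      have h3 := hΛ z hz (w - z) ((hdist' w hw).trans (min_le_left _ _))
      rw [add_sub_cancel, norm_sub_rev] at h3
      have h4 : ‖fderiv ℝ ρ z - fderiv ℝ ρ w‖ * ‖(w : Cd (e + 1)) - z‖ ≤ Λ * (s / c) :=
        calc _ ≤ Λ * ‖(w : Cd (e + 1)) - z‖ * ‖(w : Cd (e + 1)) - z‖ := by gcongr
          _ = Λ * ‖(w : Cd (e + 1)) - z‖ ^ 2 := by ring
          _ ≤ _ := by gcongr; exact hdist w hw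
      have h5 : ‖bilinPairing (complexGradient ρ z) ((w : Cd (e + 1)) - z)‖ ≤ (M + Λ / c) * s := by
        have := norm_sub_norm_le (bilinPairing (complexGradient ρ z) ((w : Cd (e + 1)) - z))
          (bilinPairing (complexGradient ρ w) ((w : Cd (e + 1)) - z))
        calc _ ≤ M * s + Λ * (s / c) := by linarith
          _ = _ := by ring
      refine (Complex.abs_im_le_norm _).trans ?_
      rw [hU, norm_div, Complex.norm_real, norm_norm, hK₁]
      calc _ ≤ (M + Λ / c) * s / m := by gcongr
        _ = _ := by ring
    · intro p
      refine (norm_le_pi_norm (f w) (some p)).trans ((norm_realCoords_le _).trans ?_)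
      rwa [U.norm_map]
  have hanti : ∀ x ∈ A, ∀ y ∈ A, edist x y ≤ K * edist (f x) (f y) := by
    intro x hx y hy
    set v : Cd (e + 1) := x - y with hv
    have h1 := abs_sub_sub_fderiv_le h hΛ0 (hΛ z hz) (min_le_left _ _) (hdist' y hy) (hdist' x hx)
    rw [h.eq_zero_of_mem_frontier x.2, h.eq_zero_of_mem_frontier y.2, sub_zero, zero_sub, abs_neg,
      ← hr, ← hv] at h1
    have hre : |(U v 0).re| ≤ ‖v‖ / 2 := by
      have e1 : (U v 0).re = fderiv ℝ ρ z v / (2 * ‖complexGradient ρ z‖) := by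
        rw [hU, fderiv_eq_two_re, Complex.div_ofReal_re]
        field_simp
      rw [e1, abs_div, abs_of_pos (by positivity : 0 < 2 * ‖complexGradient ρ z‖),
        div_le_iff₀ (by positivity)]
      have h2 : Λ * r ≤ m := by
        have : r ≤ m / (Λ + 1) := min_le_right _ _
        rw [le_div_iff₀ (by positivity)] at this
        nlinarith
      calc _ ≤ Λ * r * ‖v‖ := h1
        _ ≤ ‖complexGradient ρ z‖ * ‖v‖ := by gcongr; linarith
        _ = _ := by ring
    have hfv : f x - f y = realCoords (U v) := by
      rw [hf, hv]
      simp only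
      rw [← realCoords_sub, ← map_sub]
      congr 2
      abel
    have h3 := norm_sq_le_re_add_norm (U v)
    rw [U.norm_map, ← hfv] at h3
    have h4 : (U v 0).re ^ 2 ≤ (‖v‖ / 2) ^ 2 := by
      rw [← sq_abs]; gcongr
    have h5 : ‖v‖ ≤ 2 * (2 * e + 1) * ‖f x - f y‖ := by
      refine (pow_le_pow_iff_left₀ (norm_nonneg _) (by positivity) two_ne_zero).1 ?_
      have h6 : ((2 : ℝ) * e + 1) * ‖f x - f y‖ ^ 2 ≤ (2 * e + 1) ^ 2 * ‖f x - f y‖ ^ 2 := by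
        gcongr
        nlinarith [Nat.cast_nonneg (α := ℝ) e]
      nlinarith
    have h7 : dist x y ≤ K * dist (f x) (f y) := by
      rw [Subtype.dist_eq, dist_eq_norm, dist_eq_norm, hK]
      push_cast
      exact h5
    rw [edist_dist, edist_dist, ← ENNReal.ofReal_coe_nnreal, ← ENNReal.ofReal_mul K.coe_nonneg]
    exact ENNReal.ofReal_le_ofReal h7
  have hmain := euclideanHausdorffMeasure_le_of_antilipschitz hanti
  rw [card_option_prod_bool] at hmain
  rw [surfaceMeasure_eq]
  refine hmain.trans ?_
  have hvol : volume (f '' A) ≤ ENNReal.ofReal (2 * (K₁ * s) * (2 * √(s / c)) ^ (2 * e)) := by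
    rw [← volume_coordBox (by positivity) (by positivity)]
    exact measure_mono himage
  have hpow : (2 * √(s / c)) ^ (2 * e) = (4 / c) ^ e * s ^ e := by
    rw [pow_mul, mul_pow, Real.sq_sqrt (by positivity), ← mul_pow]
    congr 1
    ring
  calc _ ≤ (κ : ENNReal) * (K ^ (2 * e + 1) *
        ENNReal.ofReal (2 * (K₁ * s) * (2 * √(s / c)) ^ (2 * e))) := by
        gcongr
    _ = ENNReal.ofReal (κ * K ^ (2 * e + 1) * (2 * K₁ * (4 / c) ^ e) * s ^ (e + 1)) := by
        rw [← ENNReal.ofReal_coe_nnreal, ← ENNReal.ofReal_coe_nnreal,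
          ← ENNReal.ofReal_pow K.coe_nonneg,
          ← ENNReal.ofReal_mul (by positivity), ← ENNReal.ofReal_mul κ.coe_nonneg, hpow]
        congr 1
        ring
    _ ≤ _ := by
        refine ENNReal.ofReal_le_ofReal ?_
        gcongr
        linarith

/-- Caps of size `s` have surface area at least of order `s^d`: the boundary is a graph over its
tangent space, so the cap projects onto a box with sides of order `√s` in the complex tangential
directions and `s` in the remaining one. -/
theorem exists_le_surfaceMeasure {e : ℕ} {D : Set (Cd (e + 1))} {ρ : Cd (e + 1) → ℝ}
    (h : IsDefiningFunction D ρ) (hDb : Bornology.IsBounded D) :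
    ∃ K > 0, ∃ c > 0, ∃ s₀ > 0, ∀ z ∈ frontier D, ∀ s, 0 < s → s ≤ s₀ →
      ENNReal.ofReal (c * s ^ (e + 1)) ≤ surfaceMeasure D
        {w | ‖(w : Cd (e + 1)) - z‖ ^ 2 ≤ K * s ∧ ‖tangentFunctional ρ z w‖ ≤ K * s} := by
  obtain ⟨m, hm, M, hM, Λ, hΛ0, hmb, hMb, hΛ⟩ := exists_boundary_constants h hDb
  set E : ℝ := 2 * e + 2 with hE
  have hEpos : 1 ≤ E := by
    have := Nat.cast_nonneg (α := ℝ) e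
    linarith
  -- the height of the graph over the box of size `s` is at most `τ s`
  set τ := Λ * E / (2 * m) + 1 with hτ
  have hτpos : 1 ≤ τ := by
    have : 0 ≤ Λ * E / (2 * m) := by positivity
    linarith
  set K := E + (M * (τ + 1) + Λ * E) / m with hK
  set κ := euclideanFactor (2 * e + 1)
  have hκ : 0 < κ := pos_iff_ne_zero.2
    (Measure.addHaarScalarFactor_volume_hausdorffMeasure_ne_zero _)
  refine ⟨K, by positivity, κ * (2 * 4 ^ e), by positivity, min (1 / τ ^ 2) (1 / E),
    lt_min (by positivity) (by positivity), fun z hz s hs hss => ?_⟩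
  have hs1 : s * τ ^ 2 ≤ 1 := (le_div_iff₀ (by positivity)).1 (hss.trans (min_le_left _ _))
  have hs2 : s * E ≤ 1 := (le_div_iff₀ (by positivity)).1 (hss.trans (min_le_right _ _))
  have hs3 : s ≤ 1 := by nlinarith
  have hG := h.complexGradient_ne_zero hz
  have hGm := hmb z hz
  have hGpos : 0 < ‖complexGradient ρ z‖ := hm.trans_le hGm
  obtain ⟨U, hU⟩ := exists_isometry_apply_zero hG
  set A : Set (frontier D) :=
    {w | ‖(w : Cd (e + 1)) - z‖ ^ 2 ≤ K * s ∧ ‖tangentFunctional ρ z w‖ ≤ K * s} with hA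
  set f : frontier D → Option (Fin e × Bool) → ℝ := fun w => realCoords (U (w - z)) with hf
  have hbox : coordBox e s (√s) ⊆ f '' A := by
    rintro x ⟨hx0, hx⟩
    have hsum : ∑ i, x i ^ 2 ≤ (2 * e + 1) * s := by
      calc ∑ i, x i ^ 2 ≤ ∑ _i : Option (Fin e × Bool), s := by
            refine Finset.sum_le_sum fun i _ => ?_
            rw [← sq_abs]
            rcases i with _ | p
            · calc |x none| ^ 2 ≤ s ^ 2 := by gcongr
                _ ≤ s := by nlinarith
            · calc |x (some p)| ^ 2 ≤ √s ^ 2 := by gcongr; exact hx p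
                _ = s := Real.sq_sqrt hs.le
        _ = _ := by
            rw [Finset.sum_const, Finset.card_univ, card_option_prod_bool, nsmul_eq_mul]
            push_cast
            ring
    set v : ℝ → Cd (e + 1) := fun t => U.symm (ofRealCoords t x) with hv
    have hUv : ∀ t, U (v t) = ofRealCoords t x := fun t => U.apply_symm_apply _
    have hvn : ∀ t, |t| ≤ τ * s → ‖v t‖ ^ 2 ≤ E * s := by
      intro t ht
      have h1 : ‖v t‖ = ‖ofRealCoords t x‖ := U.symm.norm_map _
      rw [h1, norm_sq_eq_re_add_sum, realCoords_ofRealCoords, ofRealCoords_zero]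
      have h2 : t ^ 2 ≤ s := by
        rw [← sq_abs]
        calc |t| ^ 2 ≤ (τ * s) ^ 2 := by gcongr
          _ = (s * τ ^ 2) * s := by ring
          _ ≤ 1 * s := by gcongr
          _ = s := one_mul s
      rw [hE]
      simp only
      linarith
    have hpair : ∀ t, bilinPairing (complexGradient ρ z) (v t)
        = (‖complexGradient ρ z‖ : ℂ) * ⟨t, x none⟩ := by
      intro t
      have h1 := hU (v t)
      rw [hUv, ofRealCoords_zero] at h1
      rw [h1]
      have : (‖complexGradient ρ z‖ : ℂ) ≠ 0 := by exact_mod_cast hGpos.ne'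
      field_simp
    have hvn1 : ∀ t, |t| ≤ τ * s → ‖v t‖ ≤ 1 := fun t ht =>
      (pow_le_one_iff_of_nonneg (norm_nonneg _) two_ne_zero).1
        ((hvn t ht).trans (by linarith [mul_comm E s]))
    have hval : ∀ t, |t| ≤ τ * s →
        |ρ (z + v t) - 2 * ‖complexGradient ρ z‖ * t| ≤ Λ * (E * s) := by
      intro t ht
      have h1 := abs_sub_sub_fderiv_le h hΛ0 (hΛ z hz) (hvn1 t ht) (x := z) (y := z + v t)
        (by simp) (by simp)
      rw [h.eq_zero_of_mem_frontier hz, add_sub_cancel_left, sub_zero, fderiv_eq_two_re, hpair,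
        Complex.re_ofReal_mul] at h1
      simp only at h1
      calc _ = |ρ (z + v t) - 2 * (‖complexGradient ρ z‖ * t)| := by ring_nf
        _ ≤ Λ * ‖v t‖ * ‖v t‖ := h1
        _ = Λ * ‖v t‖ ^ 2 := by ring
        _ ≤ _ := by gcongr; exact hvn t ht
    have hτs : 0 < τ * s := by positivity
    have hmτ : 2 * m * τ * s = Λ * (E * s) + 2 * m * s := by
      rw [hτ]; field_simp
    have hGτ : 2 * m * τ * s ≤ 2 * ‖complexGradient ρ z‖ * (τ * s) := by
      rw [mul_assoc _ τ s]; gcongr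
    -- the segment over `x` crosses the boundary
    obtain ⟨t, ht, hfront⟩ : ∃ t, |t| ≤ τ * s ∧ z + v t ∈ frontier D := by
      by_contra! hcon
      have hcont : Continuous fun t => z + v t :=
        continuous_const.add (U.symm.continuous.comp (continuous_ofRealCoords x))
      have hsub := (isPreconnected_Icc (a := -(τ * s)) (b := τ * s)).image _
        hcont.continuousOn |>.subset_of_disjoint_frontier h.isOpen
        ⟨z + v (-(τ * s)), ⟨-(τ * s), ⟨le_rfl, by linarith⟩, rfl⟩, by
          rw [h.mem_iff]
          have h1 := (abs_le.1 (hval (-(τ * s)) (by rw [abs_neg, abs_of_pos hτs]))).2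
          nlinarith⟩
        (by
          rw [Set.disjoint_left]
          rintro _ ⟨t, ht, rfl⟩
          exact hcon t (abs_le.2 ht))
      have hmem := hsub ⟨τ * s, ⟨by linarith, le_rfl⟩, rfl⟩
      rw [h.mem_iff] at hmem
      have h1 := (abs_le.1 (hval (τ * s) (by rw [abs_of_pos hτs]))).1
      nlinarith
    refine ⟨⟨z + v t, hfront⟩, ⟨?_, ?_⟩, ?_⟩
    · simp only [add_sub_cancel_left]
      refine (hvn t ht).trans ?_
      have : 0 ≤ (M * (τ + 1) + Λ * E) / m := by positivity
      gcongr
      linarith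
    · rw [norm_tangentFunctional, add_sub_cancel_left, div_le_iff₀ (hm.trans_le (hmb _ hfront))]
      have h1 := norm_bilinPairing_sub_le ρ (z + v t) z (v t)
      have h2 : ‖fderiv ℝ ρ (z + v t) - fderiv ℝ ρ z‖ * ‖v t‖ ≤ Λ * (E * s) :=
        calc _ ≤ Λ * ‖v t‖ * ‖v t‖ := by gcongr; exact hΛ z hz _ (hvn1 t ht)
          _ = Λ * ‖v t‖ ^ 2 := by ring
          _ ≤ _ := by gcongr; exact hvn t ht
      have h3 : ‖bilinPairing (complexGradient ρ z) (v t)‖ ≤ M * ((τ + 1) * s) := by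
        rw [hpair, norm_mul, Complex.norm_real, norm_norm]
        gcongr
        · exact hMb z hz
        · refine (Complex.norm_le_abs_re_add_abs_im _).trans ?_
          simp only
          linarith
      have h4 := norm_sub_norm_le (bilinPairing (complexGradient ρ (z + v t)) (v t))
        (bilinPairing (complexGradient ρ z) (v t))
      calc _ ≤ (M * (τ + 1) + Λ * E) * s := by linarith
        _ = (M * (τ + 1) + Λ * E) / m * s * m := by field_simp
        _ ≤ K * s * ‖complexGradient ρ (z + v t)‖ := by
          gcongr
          · rw [hK]; linarith
          · exact hmb _ hfront
    · simp only [hf, add_sub_cancel_left, hUv, realCoords_ofRealCoords]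
  have hlip : LipschitzOnWith 1 f A := by
    refine LipschitzOnWith.of_dist_le_mul fun x _ y _ => ?_
    rw [NNReal.coe_one, one_mul, dist_eq_norm, Subtype.dist_eq, dist_eq_norm]
    simp only [hf]
    rw [← realCoords_sub, ← map_sub, sub_sub_sub_cancel_right]
    exact (norm_realCoords_le _).trans (U.norm_map _).le
  have hmain := le_euclideanHausdorffMeasure_of_lipschitz hlip
  rw [card_option_prod_bool] at hmain
  rw [surfaceMeasure_eq]
  refine le_trans ?_ hmain
  have hvol := measure_mono (μ := volume) hbox
  rw [volume_coordBox hs.le (Real.sqrt_nonneg _)] at hvol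
  have hpow : (2 * √s) ^ (2 * e) = 4 ^ e * s ^ e := by
    rw [pow_mul, mul_pow, Real.sq_sqrt hs.le, ← mul_pow]
    norm_num
  calc _ = (κ : ENNReal) * ENNReal.ofReal (2 * s * (2 * √s) ^ (2 * e)) := by
        rw [← ENNReal.ofReal_coe_nnreal, ← ENNReal.ofReal_mul κ.coe_nonneg, hpow]
        congr 1
        ring
    _ ≤ _ := by gcongr

end Caps

/-! ### Void probabilities of binomial and Poisson samples -/

section Void

variable {X Ω : Type*} [MeasurableSpace X] [MeasurableSpace Ω]

/-- The properties shared by a binomial sample of `n` points and a Poisson sample of mean size `n`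
from the law `P`: the probability that the random
finite set `η` misses `A` is between `exp (-2 n P(A))` (if `P(A) ≤ 1/2`) and `exp (-n P(A))`, and
missing two disjoint sets is at most as likely as for independent events. -/
structure HasVoidBounds (P : Measure X) (μ : Measure Ω) (η : Ω → Set X) (n : ℝ) : Prop where
  finite : ∀ ω, (η ω).Finite
  nullMeasurable : ∀ A, MeasurableSet A → NullMeasurableSet {ω | Disjoint (η ω) A} μ
  le_exp : ∀ A, MeasurableSet A → μ.real {ω | Disjoint (η ω) A} ≤ Real.exp (-(n * P.real A))
  exp_le : ∀ A, MeasurableSet A → P.real A ≤ 1 / 2 →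
    Real.exp (-(2 * n * P.real A)) ≤ μ.real {ω | Disjoint (η ω) A}
  union_le : ∀ A B, MeasurableSet A → MeasurableSet B → Disjoint A B →
    μ.real {ω | Disjoint (η ω) (A ∪ B)}
      ≤ μ.real {ω | Disjoint (η ω) A} * μ.real {ω | Disjoint (η ω) B}

lemma exp_neg_two_mul_le_one_sub {p : ℝ} (h0 : 0 ≤ p) (h1 : p ≤ 1 / 2) :
    Real.exp (-(2 * p)) ≤ 1 - p := by
  have h2 : 2 * p + 1 ≤ Real.exp (2 * p) := Real.add_one_le_exp _
  rw [Real.exp_neg, inv_le_comm₀ (Real.exp_pos _) (by linarith)]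
  refine le_trans ?_ h2
  rw [inv_le_iff_one_le_mul₀ (by linarith)]
  nlinarith

lemma disjoint_image_Iio {X Ω : Type*} (W : ℕ → Ω → X) (k : ℕ) (ω : Ω) (A : Set X) :
    Disjoint ((fun i => W i ω) '' Set.Iio k) A ↔ ∀ i < k, W i ω ∉ A := by
  simp [Set.disjoint_left]

variable {P : Measure X} {μ : Measure Ω} {W : ℕ → Ω → X}

lemma nullMeasurableSet_forall_notMem (hW : ∀ i, HasLaw (W i) P μ) (k : ℕ) {A : Set X}
    (hA : MeasurableSet A) : NullMeasurableSet {ω | ∀ i < k, W i ω ∉ A} μ := by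
  have e : {ω | ∀ i < k, W i ω ∉ A} = ⋂ i ∈ Finset.range k, W i ⁻¹' Aᶜ := by
    ext ω; simp
  rw [e]
  exact Finset.nullMeasurableSet_biInter _ fun i _ =>
    (hW i).aemeasurable.nullMeasurableSet_preimage hA.compl

variable [IsProbabilityMeasure P]

lemma measureReal_forall_notMem (hW : ∀ i, HasLaw (W i) P μ) (hind : iIndepFun W μ) (k : ℕ)
    {A : Set X} (hA : MeasurableSet A) :
    μ.real {ω | ∀ i < k, W i ω ∉ A} = (1 - P.real A) ^ k := by
  have e : {ω | ∀ i < k, W i ω ∉ A} = ⋂ i ∈ Finset.range k, W i ⁻¹' Aᶜ := by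
    ext ω; simp
  rw [e, measureReal_def, hind.measure_inter_preimage_eq_mul _ fun _ _ => hA.compl,
    ENNReal.toReal_prod]
  have : ∀ i ∈ Finset.range k, (μ (W i ⁻¹' Aᶜ)).toReal = 1 - P.real A := fun i _ => by
    rw [← probReal_compl_eq_one_sub hA]
    exact (hW i).measureReal_eq (p := fun x => x ∈ Aᶜ) hA.compl
  rw [Finset.prod_congr rfl this]
  simp

lemma measureReal_union_le_one {A B : Set X} (hB : MeasurableSet B) (hAB : Disjoint A B) :
    P.real (A ∪ B) = P.real A + P.real B ∧ P.real A + P.real B ≤ 1 := by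
  have h := measureReal_union (μ := P) hAB hB
  exact ⟨h, h ▸ measureReal_le_one⟩

/-- The first `n` points of an i.i.d. sequence. -/
lemma hasVoidBounds_image_Iio (hW : ∀ i, HasLaw (W i) P μ) (hind : iIndepFun W μ) (n : ℕ) :
    HasVoidBounds P μ (fun ω => (fun i => W i ω) '' Set.Iio n) n where
  finite ω := (Set.finite_Iio n).image _
  nullMeasurable A hA := by
    simp only [disjoint_image_Iio]
    exact nullMeasurableSet_forall_notMem hW n hA
  le_exp A hA := by
    simp only [disjoint_image_Iio]
    rw [measureReal_forall_notMem hW hind n hA, ← mul_neg, Real.exp_nat_mul]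
    exact pow_le_pow_left₀ (sub_nonneg.2 measureReal_le_one) (Real.one_sub_le_exp_neg _) n
  exp_le A hA hp := by
    simp only [disjoint_image_Iio]
    rw [measureReal_forall_notMem hW hind n hA,
      show -(2 * (n : ℝ) * P.real A) = n * -(2 * P.real A) by ring, Real.exp_nat_mul]
    exact pow_le_pow_left₀ (Real.exp_pos _).le
      (exp_neg_two_mul_le_one_sub measureReal_nonneg hp) n
  union_le A B hA hB hAB := by
    simp only [disjoint_image_Iio]
    obtain ⟨h1, h2⟩ := measureReal_union_le_one (P := P) hB hAB
    rw [measureReal_forall_notMem hW hind n hA, measureReal_forall_notMem hW hind n hB,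
      measureReal_forall_notMem hW hind n (hA.union hB), h1, ← mul_pow]
    refine pow_le_pow_left₀ (by linarith) ?_ n
    have : 0 ≤ P.real A * P.real B := by positivity
    linarith

variable [IsProbabilityMeasure μ]

/-- A Poisson number of points of an i.i.d. sequence: the void probability is the generating
function of the Poisson distribution at `1 - P(A)`. -/
lemma measureReal_forall_lt_poisson_notMem (hW : ∀ i, HasLaw (W i) P μ) (hind : iIndepFun W μ)
    {N : Ω → ℕ} {r : ℝ≥0} (hN : HasLaw N (poissonMeasure r) μ)
    (hNW : IndepFun N (fun ω i => W i ω) μ) {A : Set X} (hA : MeasurableSet A) :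
    NullMeasurableSet {ω | ∀ i < N ω, W i ω ∉ A} μ ∧
      μ.real {ω | ∀ i < N ω, W i ω ∉ A} = Real.exp (-(r * P.real A)) := by
  set p := P.real A
  have hp0 : 0 ≤ 1 - p := sub_nonneg.2 measureReal_le_one
  have e : {ω | ∀ i < N ω, W i ω ∉ A}
      = ⋃ k, (N ⁻¹' {k} ∩ {ω | ∀ i < k, W i ω ∉ A}) := by
    ext ω; simp
  have hnull : ∀ k, NullMeasurableSet (N ⁻¹' {k} ∩ {ω | ∀ i < k, W i ω ∉ A}) μ := fun k =>
    (hN.aemeasurable.nullMeasurableSet_preimage (MeasurableSet.singleton k)).inter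
      (nullMeasurableSet_forall_notMem hW k hA)
  have hval : ∀ k, μ (N ⁻¹' {k} ∩ {ω | ∀ i < k, W i ω ∉ A})
      = ENNReal.ofReal (Real.exp (-r) * r ^ k / k.factorial * (1 - p) ^ k) := by
    intro k
    have ht : MeasurableSet {x : ℕ → X | ∀ i < k, x i ∉ A} := by
      have e' : {x : ℕ → X | ∀ i < k, x i ∉ A} = ⋂ i ∈ Finset.range k, (fun x => x i) ⁻¹' Aᶜ := by
        ext x; simp
      rw [e']
      exact Finset.measurableSet_biInter _ fun i _ => measurable_pi_apply i hA.compl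
    have h1 := hNW.measure_inter_preimage_eq_mul {k} _ (MeasurableSet.singleton k) ht
    have h2 : (fun ω i => W i ω) ⁻¹' {x : ℕ → X | ∀ i < k, x i ∉ A}
        = {ω | ∀ i < k, W i ω ∉ A} := rfl
    have h3 : μ (N ⁻¹' {k}) = ENNReal.ofReal (Real.exp (-r) * r ^ k / k.factorial) := by
      rw [← poissonMeasure_singleton]
      exact hN.measure_eq (p := fun x => x ∈ ({k} : Set ℕ)) (MeasurableSet.singleton k)
    rw [h2, h3] at h1
    rw [h1, ENNReal.ofReal_mul (by positivity), ← measureReal_forall_notMem hW hind k hA,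
      ofReal_measureReal]
  have hsum : HasSum (fun k : ℕ => Real.exp (-r) * r ^ k / k.factorial * (1 - p) ^ k)
      (Real.exp (-(r * p))) := by
    have h1 := (hasSum_one_poissonMeasure (r * (1 - p).toNNReal)).mul_left (Real.exp (-(r * p)))
    rw [mul_one] at h1
    convert! h1 using 1
    ext k
    rw [NNReal.coe_mul, Real.coe_toNNReal _ hp0]
    have h2 : Real.exp (-(r : ℝ)) = Real.exp (-(r * p)) * Real.exp (-(r * (1 - p))) := by
      rw [← Real.exp_add]; congr 1; ring
    rw [h2, mul_pow]
    ring
  refine ⟨e ▸ NullMeasurableSet.iUnion hnull, ?_⟩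
  rw [measureReal_def, e, measure_iUnion₀ ?_ hnull]
  · simp only [hval]
    rw [← ENNReal.ofReal_tsum_of_nonneg (fun k => by positivity) hsum.summable, hsum.tsum_eq,
      ENNReal.toReal_ofReal (Real.exp_pos _).le]
  · intro k l hkl
    refine Disjoint.aedisjoint (Set.disjoint_left.2 fun ω hk hl => hkl ?_)
    have h1 : N ω = k := hk.1
    have h2 : N ω = l := hl.1
    exact h1.symm.trans h2

lemma hasVoidBounds_image_Iio_poisson (hW : ∀ i, HasLaw (W i) P μ) (hind : iIndepFun W μ)
    {N : Ω → ℕ} {r : ℝ≥0} (hN : HasLaw N (poissonMeasure r) μ)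
    (hNW : IndepFun N (fun ω i => W i ω) μ) :
    HasVoidBounds P μ (fun ω => (fun i => W i ω) '' Set.Iio (N ω)) r where
  finite ω := (Set.finite_Iio _).image _
  nullMeasurable A hA := by
    simp only [disjoint_image_Iio]
    exact (measureReal_forall_lt_poisson_notMem hW hind hN hNW hA).1
  le_exp A hA := by
    simp only [disjoint_image_Iio]
    exact (measureReal_forall_lt_poisson_notMem hW hind hN hNW hA).2.le
  exp_le A hA _ := by
    simp only [disjoint_image_Iio]
    rw [(measureReal_forall_lt_poisson_notMem hW hind hN hNW hA).2, Real.exp_le_exp]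
    have : 0 ≤ (r : ℝ) * P.real A := by positivity
    linarith
  union_le A B hA hB hAB := by
    simp only [disjoint_image_Iio]
    rw [(measureReal_forall_lt_poisson_notMem hW hind hN hNW hA).2,
      (measureReal_forall_lt_poisson_notMem hW hind hN hNW hB).2,
      (measureReal_forall_lt_poisson_notMem hW hind hN hNW (hA.union hB)).2, ← Real.exp_add,
      (measureReal_union_le_one (P := P) hB hAB).1]
    exact (congrArg Real.exp (by ring)).le

end Void

/-! ### The second moment method -/

section SecondMoment

variable {Ω ι : Type*} [MeasurableSpace Ω] {μ : Measure Ω} [IsProbabilityMeasure μ]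

/-- Second moment method: if the events `E i` are pairwise nonpositively correlated, then the
probability that none of them occurs is at most `1 / ∑ μ(E i)`. -/
lemma measureReal_forall_notMem_le_inv_sum {s : Finset ι} {E : ι → Set Ω}
    (hE : ∀ i ∈ s, NullMeasurableSet (E i) μ)
    (hcorr : ∀ i ∈ s, ∀ j ∈ s, i ≠ j → μ.real (E i ∩ E j) ≤ μ.real (E i) * μ.real (E j))
    (hpos : 0 < ∑ i ∈ s, μ.real (E i)) :
    μ.real {ω | ∀ i ∈ s, ω ∉ E i} ≤ (∑ i ∈ s, μ.real (E i))⁻¹ := by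
  classical
  set S := ∑ i ∈ s, μ.real (E i) with hS
  set G : Set Ω := {ω | ∀ i ∈ s, ω ∉ E i} with hG
  have hGm : NullMeasurableSet G μ := by
    have e : G = ⋂ i ∈ s, (E i)ᶜ := by ext ω; simp [hG]
    rw [e]
    exact Finset.nullMeasurableSet_biInter _ fun i hi => (hE i hi).compl
  have hint : ∀ {A : Set Ω}, NullMeasurableSet A μ →
      Integrable (A.indicator fun _ => (1 : ℝ)) μ := fun hA => (integrable_const _).indicator₀ hA
  have hval : ∀ {A : Set Ω}, NullMeasurableSet A μ →
      ∫ ω, A.indicator (fun _ => (1 : ℝ)) ω ∂μ = μ.real A := fun hA => by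
    rw [integral_indicator₀ hA]; simp
  have hpt : ∀ ω, S ^ 2 * G.indicator (fun _ => (1 : ℝ)) ω ≤
      (∑ i ∈ s, ∑ j ∈ s, (E i ∩ E j).indicator (fun _ => (1 : ℝ)) ω)
        - 2 * S * ∑ i ∈ s, (E i).indicator (fun _ => (1 : ℝ)) ω + S ^ 2 := by
    intro ω
    have hsq : ∑ i ∈ s, ∑ j ∈ s, (E i ∩ E j).indicator (fun _ => (1 : ℝ)) ω
        = (∑ i ∈ s, (E i).indicator (fun _ => (1 : ℝ)) ω) ^ 2 := by
      rw [sq, Finset.sum_mul_sum]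
      refine Finset.sum_congr rfl fun i _ => Finset.sum_congr rfl fun j _ => ?_
      rw [← Set.inter_indicator_mul]
      simp
    rw [hsq]
    by_cases hω : ω ∈ G
    · have h0 : ∑ i ∈ s, (E i).indicator (fun _ => (1 : ℝ)) ω = 0 :=
        Finset.sum_eq_zero fun i hi => Set.indicator_of_notMem (hω i hi) _
      rw [h0, Set.indicator_of_mem hω]
      simp
    · rw [Set.indicator_of_notMem hω]
      nlinarith [sq_nonneg ((∑ i ∈ s, (E i).indicator (fun _ => (1 : ℝ)) ω) - S)]
  have hi1 : Integrable (fun ω => ∑ i ∈ s, ∑ j ∈ s,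
      (E i ∩ E j).indicator (fun _ => (1 : ℝ)) ω) μ :=
    integrable_finsetSum _ fun i hi => integrable_finsetSum _ fun j hj =>
      hint ((hE i hi).inter (hE j hj))
  have hi2 : Integrable (fun ω => 2 * S * ∑ i ∈ s, (E i).indicator (fun _ => (1 : ℝ)) ω) μ :=
    (integrable_finsetSum _ fun i hi => hint (hE i hi)).const_mul _
  have hmono := integral_mono ((hint hGm).const_mul (S ^ 2))
    ((hi1.sub hi2).add (integrable_const (S ^ 2))) hpt
  have hR : ∫ ω, ((∑ i ∈ s, ∑ j ∈ s, (E i ∩ E j).indicator (fun _ => (1 : ℝ)) ω)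
        - 2 * S * ∑ i ∈ s, (E i).indicator (fun _ => (1 : ℝ)) ω + S ^ 2) ∂μ
      = (∑ i ∈ s, ∑ j ∈ s, μ.real (E i ∩ E j)) - 2 * S * S + S ^ 2 := by
    refine (integral_add (hi1.sub hi2) (integrable_const (S ^ 2))).trans ?_
    refine congrArg₂ HAdd.hAdd ((integral_sub hi1 hi2).trans ?_) (by simp)
    · rw [integral_const_mul, integral_finsetSum _ fun i hi => hint (hE i hi),
        integral_finsetSum _ fun i hi => integrable_finsetSum _ fun j hj =>
          hint ((hE i hi).inter (hE j hj))]
      congr 1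
      · refine Finset.sum_congr rfl fun i hi => ?_
        rw [integral_finsetSum _ fun j hj => hint ((hE i hi).inter (hE j hj))]
        exact Finset.sum_congr rfl fun j hj => hval ((hE i hi).inter (hE j hj))
      · rw [hS]
        congr 1
        exact Finset.sum_congr rfl fun i hi => hval (hE i hi)
  have hL : ∫ ω, S ^ 2 * G.indicator (fun _ => (1 : ℝ)) ω ∂μ = S ^ 2 * μ.real G := by
    rw [integral_const_mul, hval hGm]
  have hdouble : ∑ i ∈ s, ∑ j ∈ s, μ.real (E i ∩ E j) ≤ S + S ^ 2 := by
    have h1 : ∀ i ∈ s, ∑ j ∈ s, μ.real (E i ∩ E j) ≤ μ.real (E i) + μ.real (E i) * S := by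
      intro i hi
      rw [← Finset.add_sum_erase s _ hi, Set.inter_self, hS, Finset.mul_sum]
      gcongr
      calc ∑ j ∈ s.erase i, μ.real (E i ∩ E j)
          ≤ ∑ j ∈ s.erase i, μ.real (E i) * μ.real (E j) :=
            Finset.sum_le_sum fun j hj => hcorr i hi j (Finset.mem_of_mem_erase hj)
              (Finset.ne_of_mem_erase hj).symm
        _ ≤ _ := Finset.sum_le_sum_of_subset_of_nonneg (Finset.erase_subset _ _)
            fun _ _ _ => by positivity
    refine (Finset.sum_le_sum h1).trans ?_
    rw [Finset.sum_add_distrib, ← Finset.sum_mul, ← hS, sq]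
  have hfinal : S ^ 2 * μ.real G ≤ S := by
    have := hL ▸ (hmono.trans_eq hR)
    linarith
  rw [← one_div, le_div_iff₀ hpos]
  nlinarith

end SecondMoment

/-! ### Separated sets -/

section Nets

/-- Compact metric spaces have finite maximal separated sets. -/
lemma exists_finset_separated_cover {X : Type*} [PseudoMetricSpace X] [CompactSpace X] (A : Set X)
    {ε : ℝ} (hε : 0 < ε) :
    ∃ t : Finset X, ↑t ⊆ A ∧ (∀ x ∈ t, ∀ y ∈ t, x ≠ y → ε < dist x y) ∧
      ∀ x ∈ A, ∃ y ∈ t, dist x y ≤ ε := by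
  lift ε to ℝ≥0 using hε.le
  have hε' : 0 < ε := by exact_mod_cast hε
  have hA : TotallyBounded A := isCompact_univ.totallyBounded.subset (Set.subset_univ _)
  have hfin : Metric.packingNumber ε A ≠ ⊤ := by
    obtain ⟨N, -, hN, hcov⟩ := Metric.exists_finite_isCover_of_totallyBounded
      (ε := ε / 2) (by positivity) hA
    have h1 := Metric.packingNumber_two_mul_le_externalCoveringNumber (ε / 2) A
    rw [mul_div_cancel₀ _ two_ne_zero] at h1
    exact ne_top_of_le_ne_top (Set.encard_ne_top_iff.2 hN)
      (h1.trans hcov.externalCoveringNumber_le_encard)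
  have hTfin : (Metric.maximalSeparatedSet ε A).Finite := by
    rw [← Set.encard_ne_top_iff, Metric.encard_maximalSeparatedSet hfin]
    exact hfin
  refine ⟨hTfin.toFinset, ?_, fun x hx y hy hxy => ?_, fun x hx => ?_⟩
  · rw [hTfin.coe_toFinset]
    exact Metric.maximalSeparatedSet_subset
  · have h1 : (ε : ENNReal) < edist x y :=
      Metric.isSeparated_maximalSeparatedSet (hTfin.mem_toFinset.1 hx)
      (hTfin.mem_toFinset.1 hy) hxy
    rw [edist_nndist, ENNReal.coe_lt_coe] at h1
    exact_mod_cast h1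
  · obtain ⟨y, hy, hxy⟩ := Metric.isCover_maximalSeparatedSet hfin hx
    refine ⟨y, hTfin.mem_toFinset.2 hy, ?_⟩
    have h2 : edist x y ≤ ε := hxy
    rw [edist_nndist, ENNReal.coe_le_coe] at h2
    exact_mod_cast h2

variable {X ι : Type*} [MeasurableSpace X] {P : Measure X} [IsProbabilityMeasure P]

lemma card_mul_le_one_of_disjoint {t : Finset ι} {B : ι → Set X} {p : ℝ}
    (hB : ∀ i ∈ t, MeasurableSet (B i)) (hd : (t : Set ι).PairwiseDisjoint B)
    (hp : ∀ i ∈ t, p ≤ P.real (B i)) : t.card * p ≤ 1 := by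
  rw [← nsmul_eq_mul]
  refine (Finset.card_nsmul_le_sum t _ p hp).trans ?_
  rw [← measureReal_biUnion_finset hd hB]
  exact measureReal_le_one

lemma measureReal_le_card_mul_of_cover {t : Finset ι} {B : ι → Set X} {A : Set X} {q : ℝ}
    (hA : A ⊆ ⋃ i ∈ t, B i) (hq : ∀ i ∈ t, P.real (B i) ≤ q) : P.real A ≤ t.card * q := by
  rw [← nsmul_eq_mul]
  exact (measureReal_mono hA (measure_ne_top _ _)).trans
    ((measureReal_biUnion_finset_le _ _).trans (Finset.sum_le_card_nsmul t _ q hq))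

end Nets

/-! ### The sampling law of boundary caps -/

section SampleLaw

lemma isProbabilityMeasure_sampleLaw {d : ℕ} {D : Set (Cd d)} {f : frontier D → ℝ}
    (hf : IsBoundedDensity D f) : IsProbabilityMeasure (sampleLaw D f) := by
  obtain ⟨m, hm, hmf⟩ := hf.bounded_away
  have hint : Integrable f (surfaceMeasure D) := by
    by_contra hcon
    have := hf.integral_eq_one
    rw [integral_undef hcon] at this
    exact zero_ne_one this
  refine ⟨?_⟩
  rw [sampleLaw, withDensity_apply _ MeasurableSet.univ, Measure.restrict_univ,
    ← ofReal_integral_eq_lintegral_ofReal hint (Eventually.of_forall fun w => hm.le.trans (hmf w)),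
    hf.integral_eq_one, ENNReal.ofReal_one]

lemma sampleLaw_real_le {d : ℕ} {D : Set (Cd d)} {f : frontier D → ℝ} {M a : ℝ} (hM : 0 ≤ M)
    (ha : 0 ≤ a) (hf : ∀ w, f w ≤ M) {A : Set (frontier D)} (hA : MeasurableSet A)
    (h : surfaceMeasure D A ≤ ENNReal.ofReal a) : (sampleLaw D f).real A ≤ M * a := by
  refine ENNReal.toReal_le_of_le_ofReal (by positivity) ?_
  rw [sampleLaw, withDensity_apply _ hA, ENNReal.ofReal_mul hM]
  calc ∫⁻ w in A, ENNReal.ofReal (f w) ∂surfaceMeasure D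
      ≤ ∫⁻ _ in A, ENNReal.ofReal M ∂surfaceMeasure D :=
        lintegral_mono fun w => ENNReal.ofReal_le_ofReal (hf w)
    _ = ENNReal.ofReal M * surfaceMeasure D A := by simp
    _ ≤ _ := by gcongr

lemma le_sampleLaw_real {d : ℕ} {D : Set (Cd d)} {f : frontier D → ℝ}
    [IsFiniteMeasure (sampleLaw D f)] {m a : ℝ} (hm : 0 ≤ m)
    (hf : ∀ w, m ≤ f w) {A : Set (frontier D)} (hA : MeasurableSet A)
    (h : ENNReal.ofReal a ≤ surfaceMeasure D A) : m * a ≤ (sampleLaw D f).real A := by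
  rw [measureReal_def, ← ENNReal.ofReal_le_iff_le_toReal (measure_ne_top _ _), sampleLaw,
    withDensity_apply _ hA, ENNReal.ofReal_mul hm]
  calc ENNReal.ofReal m * ENNReal.ofReal a ≤ ENNReal.ofReal m * surfaceMeasure D A := by gcongr
    _ = ∫⁻ _ in A, ENNReal.ofReal m ∂surfaceMeasure D := by simp
    _ ≤ _ := lintegral_mono fun w => ENNReal.ofReal_le_ofReal (hf w)

lemma continuous_norm_tangentFunctional {d : ℕ} {D : Set (Cd d)} {ρ : Cd d → ℝ}
    (h : IsDefiningFunction D ρ) (z : Cd d) :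
    Continuous fun w : frontier D => ‖tangentFunctional ρ z w‖ := by
  simp only [norm_tangentFunctional]
  have cG : Continuous fun w : frontier D => complexGradient ρ w :=
    (continuous_complexGradient h.contDiff).comp continuous_subtype_val
  refine Continuous.div ?_ cG.norm fun w => norm_ne_zero_iff.2 (h.complexGradient_ne_zero w.2)
  exact (continuous_bilinPairing.comp
    (cG.prodMk (continuous_subtype_val.sub continuous_const))).norm

variable {e : ℕ} {D : Set (Cd (e + 1))} {ρ : Cd (e + 1) → ℝ} {f : frontier D → ℝ}

lemma exists_sampleLaw_cap_le (h : IsDefiningFunction D ρ) (hDb : Bornology.IsBounded D)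
    (hD : IsConnected D) (hf : IsBoundedDensity D f)
    (hH : ∀ w ∈ frontier D, ∀ v ∈ complexTangentSpace ρ w, v ≠ 0 →
      0 < fderiv ℝ (fderiv ℝ ρ) w v v) :
    ∃ C > 0, ∃ s₀ > 0, ∀ z ∈ frontier D, ∀ s, 0 < s → s ≤ s₀ →
      (sampleLaw D f).real {w | ‖tangentFunctional ρ z w‖ ≤ s} ≤ C * s ^ (e + 1) := by
  obtain ⟨C, hC, s₀, hs₀, hb⟩ := exists_surfaceMeasure_le h hDb hD hH
  obtain ⟨M, hM⟩ := hf.bounded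
  refine ⟨max M 1 * C, by positivity, s₀, hs₀, fun z hz s hs hss => ?_⟩
  rw [mul_assoc]
  exact sampleLaw_real_le (by positivity) (by positivity) (fun w => (hM w).trans (le_max_left _ _))
    (isClosed_le (continuous_norm_tangentFunctional h z) continuous_const).measurableSet
    (hb z hz s hs hss)

lemma exists_le_sampleLaw_cap (h : IsDefiningFunction D ρ) (hDb : Bornology.IsBounded D)
    (hf : IsBoundedDensity D f) :
    ∃ K > 0, ∃ c > 0, ∃ s₀ > 0, ∀ z ∈ frontier D, ∀ s, 0 < s → s ≤ s₀ →
      c * s ^ (e + 1) ≤ (sampleLaw D f).real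
        {w | ‖(w : Cd (e + 1)) - z‖ ^ 2 ≤ K * s ∧ ‖tangentFunctional ρ z w‖ ≤ K * s} := by
  obtain ⟨K, hK, c, hc, s₀, hs₀, hb⟩ := exists_le_surfaceMeasure h hDb
  obtain ⟨m, hm, hmf⟩ := hf.bounded_away
  have := isProbabilityMeasure_sampleLaw hf
  refine ⟨K, hK, m * c, by positivity, s₀, hs₀, fun z hz s hs hss => ?_⟩
  rw [mul_assoc]
  refine le_sampleLaw_real hm.le hmf ?_ (hb z hz s hs hss)
  have h1 : Continuous fun w : frontier D => ‖(w : Cd (e + 1)) - z‖ ^ 2 := by fun_prop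
  exact ((isClosed_le h1 continuous_const).inter
    (isClosed_le (continuous_norm_tangentFunctional h z) continuous_const)).measurableSet

end SampleLaw

/-! ### Containment of the polyhedron in terms of covering of the boundary by tubes -/

section Containment

variable {d : ℕ} {D : Set (Cd d)} {ρ : Cd d → ℝ}

/-- If no tube contains the boundary point `z`, the polyhedron contains `z` and so leaves `D`. -/
lemma not_disjoint_of_inducedPolyhedron_subset (h : IsDefiningFunction D ρ)
    {φ : Set (frontier D)} (hφ : φ.Finite) {δ : frontier D → ℝ}
    (hsub : inducedPolyhedron D ρ φ δ ⊆ D) {z : Cd d} (hz : z ∈ frontier D) :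
    ¬ Disjoint φ {w | ‖tangentFunctional ρ z w‖ ≤ δ w} := by
  intro hdis
  have hzT : z ∈ tubeComplement D ρ φ δ := fun w hw => by
    by_contra! hle
    exact Set.disjoint_left.1 hdis hw hle
  have hopen : IsOpen (tubeComplement D ρ φ δ) := by
    have e : tubeComplement D ρ φ δ = ⋂ w ∈ φ, {z | δ w < ‖tangentFunctional ρ z w‖} := by
      ext z; simp [tubeComplement]
    rw [e]
    refine hφ.isOpen_biInter fun w _ => isOpen_lt continuous_const ?_
    simp only [norm_tangentFunctional]
    exact (continuous_bilinPairing.comp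
      (continuous_const.prodMk (continuous_const.sub continuous_id))).norm.div_const _
  obtain ⟨r, hr, hball⟩ := Metric.isOpen_iff.1 hopen z hzT
  obtain ⟨y, hyD, hy⟩ := Metric.mem_closure_iff.1 (frontier_subset_closure hz) r hr
  refine h.notMem_of_mem_frontier hz (hsub ⟨hzT, y, ?_, hyD⟩)
  exact (convex_ball z r).isPreconnected.subset_connectedComponentIn (Metric.mem_ball_self hr)
    hball (by rwa [Metric.mem_ball, dist_comm])

/-- If the tubes cover the boundary, no component of their complement crosses it. -/
lemma inducedPolyhedron_subset_of_cover (h : IsDefiningFunction D ρ) {φ : Set (frontier D)}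
    {δ : frontier D → ℝ}
    (hcov : ∀ z ∈ frontier D, ∃ w ∈ φ, ‖tangentFunctional ρ z w‖ ≤ δ w) :
    inducedPolyhedron D ρ φ δ ⊆ D := by
  rintro z ⟨hzT, hne⟩
  refine isPreconnected_connectedComponentIn.subset_of_disjoint_frontier h.isOpen hne ?_
    (mem_connectedComponentIn hzT)
  rw [Set.disjoint_left]
  intro y hy hyf
  obtain ⟨w, hw, hle⟩ := hcov y hyf
  exact absurd (connectedComponentIn_subset _ _ hy w hw) (not_lt.2 hle)

lemma containmentProb_congr {ρ' : Cd d → ℝ} (h : IsDefiningFunction D ρ)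
    (h' : IsDefiningFunction D ρ') {Ω : Type*} [MeasurableSpace Ω] (μ : Measure Ω)
    (η : Ω → Set (frontier D)) (δ : frontier D → ℝ) :
    containmentProb D ρ' μ η δ = containmentProb D ρ μ η δ := by
  simp only [containmentProb, inducedPolyhedron_congr h h']

end Containment

/-! ### The scale of the tubes -/

section Scale

/-- The scale `(log n / n)^(1/d)`. -/
noncomputable def tubeScale (d n : ℕ) : ℝ := (Real.log n / n) ^ (1 / (d : ℝ))

lemma log_div_nonneg (n : ℕ) : 0 ≤ Real.log n / n :=
  div_nonneg (Real.log_natCast_nonneg n) n.cast_nonneg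

lemma tubeScale_pow {d : ℕ} (hd : d ≠ 0) (n : ℕ) : tubeScale d n ^ d = Real.log n / n := by
  rw [tubeScale, one_div, Real.rpow_inv_natCast_pow (log_div_nonneg n) hd]

lemma tubeScale_pos (d : ℕ) {n : ℕ} (hn : 2 ≤ n) : 0 < tubeScale d n := by
  have h1 : (1 : ℝ) < n := by exact_mod_cast hn
  have := Real.log_pos h1
  unfold tubeScale
  positivity

lemma tendsto_log_div_atTop : Tendsto (fun n : ℕ => Real.log n / n) atTop (𝓝 0) := by
  exact (Real.isLittleO_log_id_atTop.comp_tendsto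
    tendsto_natCast_atTop_atTop).tendsto_div_nhds_zero

lemma tendsto_tubeScale {d : ℕ} (hd : d ≠ 0) : Tendsto (tubeScale d) atTop (𝓝 0) := by
  have h0 : (0 : ℝ) < 1 / (d : ℝ) := by positivity
  have h := tendsto_log_div_atTop.rpow_const (p := 1 / (d : ℝ)) (Or.inr h0.le)
  rwa [Real.zero_rpow h0.ne'] at h

/-- `√(log n / n) n^(1/4) → 0`. -/
lemma tendsto_sqrt_log_div_mul_exp :
    Tendsto (fun n : ℕ => √(Real.log n / n) * Real.exp (Real.log n / 4)) atTop (𝓝 0) := by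
  have h1 : Tendsto (fun n : ℕ => Real.log n / (n : ℝ) ^ (1 / 2 : ℝ)) atTop (𝓝 0) :=
    ((isLittleO_log_rpow_atTop (by norm_num : (0 : ℝ) < 1 / 2)).comp_tendsto
      tendsto_natCast_atTop_atTop).tendsto_div_nhds_zero
  have h2 := h1.sqrt
  rw [Real.sqrt_zero] at h2
  refine h2.congr' ?_
  filter_upwards [eventually_gt_atTop 0] with n hn
  have hn' : (0 : ℝ) < n := by exact_mod_cast hn
  have e1 : Real.exp (Real.log n / 4) = √(Real.exp (Real.log n / 2)) := by
    rw [← Real.exp_half]; congr 1; ring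
  rw [e1, ← Real.sqrt_mul (log_div_nonneg n), Real.rpow_def_of_pos hn']
  congr 1
  have e2 : (n : ℝ) = Real.exp (Real.log n / 2) * Real.exp (Real.log n / 2) := by
    rw [← Real.exp_add, add_halves, Real.exp_log hn']
  have e3 : Real.log n * (1 / 2) = Real.log n / 2 := by ring
  rw [e3]
  nth_rewrite 4 [e2]
  have := Real.exp_pos (Real.log n / 2)
  field_simp

end Scale

/-! ### Asymptotics of the containment probability -/

section Asymptotic

variable {e : ℕ} {D : Set (Cd (e + 1))} {ρ : Cd (e + 1) → ℝ} {f : frontier D → ℝ}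

lemma measurableSet_tube {d : ℕ} {D : Set (Cd d)} {ρ : Cd d → ℝ} (h : IsDefiningFunction D ρ)
    {δ : frontier D → ℝ} (hδ : Continuous δ) (z : Cd d) :
    MeasurableSet {w : frontier D | ‖tangentFunctional ρ z w‖ ≤ δ w} :=
  (isClosed_le (continuous_norm_tangentFunctional h z) hδ).measurableSet

/-- Small tubes: near a point where `g` is small there are at least of order `(n / log n)^(1/2)`
boundary points with disjoint caps, each of them missed by the sample with probability at least
`n^(-1/4)`; by the second moment method one of them is missed with high probability. -/
theorem tendsto_containmentProb_zero (h : IsDefiningFunction D ρ) (hDb : Bornology.IsBounded D)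
    (hD : IsConnected D) (hf : IsBoundedDensity D f)
    (hH : ∀ w ∈ frontier D, ∀ v ∈ complexTangentSpace ρ w, v ≠ 0 →
      0 < fderiv ℝ (fderiv ℝ ρ) w v v) :
    ∃ c > 0, ∀ g : frontier D → ℝ, Continuous g → (∀ w, 0 < g w) → (⨅ w, g w) < c →
      ∀ {Ω : Type*} [MeasurableSpace Ω] (μ : Measure Ω) [IsProbabilityMeasure μ]
        (η : ℕ → Ω → Set (frontier D)),
        (∀ n : ℕ, HasVoidBounds (sampleLaw D f) μ (η n) n) →
        Tendsto (fun n => containmentProb D ρ μ (η n) (scaledSize g n)) atTop (𝓝 0) := by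
  obtain ⟨C, hC, s₀, hs₀, hUB⟩ := exists_sampleLaw_cap_le h hDb hD hf hH
  obtain ⟨K, hK, k, hk, s₁, hs₁, hLB⟩ := exists_le_sampleLaw_cap h hDb hf
  obtain ⟨q, hq, hquad⟩ := exists_sq_le_norm_tangentFunctional h hDb hD hH
  have hprob := isProbabilityMeasure_sampleLaw hf
  set P := sampleLaw D f with hP
  have : CompactSpace (frontier D) := isCompact_iff_compactSpace.1 (isCompact_frontier hDb)
  have : Nonempty (frontier D) := nonempty_of_isProbabilityMeasure P
  -- `C c^d ≤ 1 / 8` makes the caps' probability at most `log n / (8 n)`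
  set c := min 1 (1 / (8 * C)) with hc
  have hcpos : 0 < c := lt_min one_pos (by positivity)
  have hCc : C * c ^ (e + 1) ≤ 1 / 8 := by
    have h1 : c ^ (e + 1) ≤ c := pow_le_of_le_one hcpos.le (min_le_left _ _) (by omega)
    have h2 : c ≤ 1 / (8 * C) := min_le_right _ _
    calc C * c ^ (e + 1) ≤ C * (1 / (8 * C)) := by gcongr; exact h1.trans h2
      _ = 1 / 8 := by field_simp
  refine ⟨c, hcpos, fun g hg hgpos hgc Ω _ μ _ η hη => ?_⟩
  obtain ⟨w₀, hw₀⟩ := exists_lt_of_ciInf_lt hgc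
  obtain ⟨R, hR, hgR⟩ := Metric.eventually_nhds_iff.1 (hg.continuousAt.eventually_lt
    (continuousAt_const (y := c)) hw₀)
  obtain ⟨G, hG⟩ : ∃ G, ∀ w, g w ≤ G := by
    obtain ⟨G, hG⟩ := (isCompact_range hg).bddAbove
    exact ⟨G, fun w => hG ⟨w, rfl⟩⟩
  set A₀ : Set (frontier D) := Metric.closedBall w₀ (R / 2) with hA₀
  have hm₀ : 0 < P.real A₀ := by
    set s := min s₁ ((R / 2) ^ 2 / K) with hs
    have hspos : 0 < s := lt_min hs₁ (by positivity)
    have h1 := hLB w₀ w₀.2 s hspos (min_le_left _ _)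
    refine lt_of_lt_of_le (by positivity) (h1.trans (measureReal_mono ?_ (measure_ne_top _ _)))
    rintro w ⟨hw, -⟩
    rw [Metric.mem_closedBall, Subtype.dist_eq, dist_eq_norm]
    refine (pow_le_pow_iff_left₀ (norm_nonneg _) (by positivity) two_ne_zero).1 (hw.trans ?_)
    have h2 : s ≤ (R / 2) ^ 2 / K := min_le_right _ _
    rw [le_div_iff₀ hK] at h2
    linarith
  set B := 2 * √(c / q) with hB
  have hBpos : 0 < B := by positivity
  set m₀ := P.real A₀
  have hlim : Tendsto (fun n : ℕ => C * B ^ (e + 1) / m₀ *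
      (√(Real.log n / n) * Real.exp (Real.log n / 4))) atTop (𝓝 0) := by
    simpa using tendsto_sqrt_log_div_mul_exp.const_mul (C * B ^ (e + 1) / m₀)
  have ht := tendsto_tubeScale (d := e + 1) (by omega)
  have hev1 : ∀ᶠ n in atTop, c * tubeScale (e + 1) n < s₀ :=
    (by simpa using ht.const_mul c : Tendsto (fun n => c * tubeScale (e + 1) n) atTop (𝓝 0))
      |>.eventually_lt_const hs₀
  have hev2 : ∀ᶠ n in atTop, G / q * tubeScale (e + 1) n < (R / 2) ^ 2 :=
    (by simpa using ht.const_mul (G / q) :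
      Tendsto (fun n => G / q * tubeScale (e + 1) n) atTop (𝓝 0))
      |>.eventually_lt_const (by positivity)
  have hev3 : ∀ᶠ n in atTop, B * √(tubeScale (e + 1) n) < s₀ :=
    (by simpa using ht.sqrt.const_mul B :
      Tendsto (fun n => B * √(tubeScale (e + 1) n)) atTop (𝓝 0)).eventually_lt_const hs₀
  refine squeeze_zero' (Eventually.of_forall fun n => measureReal_nonneg) ?_ hlim
  filter_upwards [hev1, hev2, hev3, eventually_ge_atTop 2] with n h1 h2 h3 hn
  set a := tubeScale (e + 1) n with ha
  have hapos : 0 < a := tubeScale_pos _ hn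
  have hn0 : (0 : ℝ) < n := by positivity
  have hlog : 0 ≤ Real.log n := Real.log_natCast_nonneg n
  have hapow : a ^ (e + 1) = Real.log n / n := tubeScale_pow (by omega) n
  -- twice the radius `√(c a / q)` that the caps cannot exceed
  set σ := B * √a with hσ
  have hσpos : 0 < σ := by positivity
  obtain ⟨t, htA, htsep, htcov⟩ := exists_finset_separated_cover A₀ hσpos
  set δ := scaledSize g n with hδ
  set cap : frontier D → Set (frontier D) := fun z =>
    {w | ‖tangentFunctional ρ z w‖ ≤ δ w} with hcap
  have hδc : Continuous δ := hg.mul continuous_const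
  have hcapm : ∀ z, MeasurableSet (cap z) := fun z => measurableSet_tube h hδc z
  -- caps around points near `w₀` stay in the region where `g < c`
  have hloc : ∀ z ∈ t, ∀ w ∈ cap z, ‖tangentFunctional ρ z w‖ ≤ c * a ∧ dist w z ≤ σ / 2 := by
    intro z hz w hw
    have hw' : ‖tangentFunctional ρ z w‖ ≤ g w * a := hw
    have hqw := hquad z z.2 w w.2
    have hzA : dist z w₀ ≤ R / 2 := htA hz
    have hdw : dist w z < R / 2 := by
      rw [Subtype.dist_eq, dist_eq_norm]
      refine (pow_lt_pow_iff_left₀ (norm_nonneg _) (by positivity) two_ne_zero).1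
        (lt_of_le_of_lt ?_ h2)
      rw [div_mul_eq_mul_div, le_div_iff₀ hq, mul_comm]
      refine hqw.trans (hw'.trans ?_)
      gcongr
      exact hG w
    have hgw : g w < c := hgR (by linarith [dist_triangle w z w₀])
    have hwc : ‖tangentFunctional ρ z w‖ ≤ c * a := hw'.trans (by gcongr)
    refine ⟨hwc, ?_⟩
    have e1 : σ / 2 = √(c / q * a) := by
      rw [hσ, hB, Real.sqrt_mul (by positivity)]; ring
    rw [e1, Subtype.dist_eq, dist_eq_norm]
    refine Real.le_sqrt_of_sq_le ?_
    rw [div_mul_eq_mul_div, le_div_iff₀ hq, mul_comm]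
    exact hqw.trans hwc
  have hcapP : ∀ z ∈ t, n * P.real (cap z) ≤ Real.log n / 8 := by
    intro z hz
    have h4 : P.real (cap z) ≤ C * (c * a) ^ (e + 1) :=
      (measureReal_mono (fun w hw => (hloc z hz w hw).1) (measure_ne_top _ _)).trans
        (hUB z z.2 (c * a) (by positivity) h1.le)
    calc n * P.real (cap z) ≤ n * (C * (c * a) ^ (e + 1)) := by gcongr
      _ = (C * c ^ (e + 1)) * Real.log n := by
        rw [mul_pow, hapow]; field_simp
      _ ≤ 1 / 8 * Real.log n := by gcongr
      _ = _ := by ring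
  have hhalf : ∀ z ∈ t, P.real (cap z) ≤ 1 / 2 := by
    intro z hz
    have h4 := hcapP z hz
    have h5 : Real.log n ≤ n := (Real.log_le_sub_one_of_pos hn0).trans (by linarith)
    have h6 : n * P.real (cap z) ≤ n * (1 / 2) := by linarith
    exact le_of_mul_le_mul_left h6 hn0
  have hdisj : ∀ y ∈ t, ∀ z ∈ t, y ≠ z → Disjoint (cap y) (cap z) := by
    intro y hy z hz hyz
    rw [Set.disjoint_left]
    intro w hwy hwz
    have h4 := (hloc y hy w hwy).2
    have h5 := (hloc z hz w hwz).2
    have h6 := htsep y hy z hz hyz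
    have h7 := dist_triangle_left y z w
    linarith
  set E : frontier D → Set Ω := fun z => {ω | Disjoint (η n ω) (cap z)} with hE
  have hEv : ∀ z ∈ t, Real.exp (-(Real.log n / 4)) ≤ μ.real (E z) := fun z hz => by
    refine le_trans (Real.exp_le_exp.2 ?_) ((hη n).exp_le _ (hcapm z) (hhalf z hz))
    have := hcapP z hz
    linarith
  have hcard : m₀ ≤ t.card * (C * σ ^ (e + 1)) := by
    refine measureReal_le_card_mul_of_cover
      (B := fun z : frontier D => {w : frontier D | ‖tangentFunctional ρ z w‖ ≤ σ})
      (fun w hw => ?_) fun z _ => hUB z z.2 σ hσpos h3.le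
    obtain ⟨z, hz, hwz⟩ := htcov w hw
    refine Set.mem_biUnion hz ?_
    refine (norm_tangentFunctional_le ρ z w).trans ?_
    rwa [← dist_eq_norm, ← Subtype.dist_eq]
  have hσpow : σ ^ (e + 1) = B ^ (e + 1) * √(Real.log n / n) := by
    rw [hσ, mul_pow, ← hapow, Real.sqrt_eq_rpow, Real.sqrt_eq_rpow,
      ← Real.rpow_natCast_mul hapos.le,
      ← Real.rpow_mul_natCast hapos.le, mul_comm (1 / 2 : ℝ)]
  have hX : 0 < C * σ ^ (e + 1) := by positivity
  have hS : m₀ / (C * σ ^ (e + 1)) * Real.exp (-(Real.log n / 4)) ≤ ∑ z ∈ t, μ.real (E z) := by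
    refine le_trans ?_ (Finset.card_nsmul_le_sum t _ _ hEv)
    rw [nsmul_eq_mul]
    gcongr
    exact (div_le_iff₀ hX).2 hcard
  have hSpos : 0 < m₀ / (C * σ ^ (e + 1)) * Real.exp (-(Real.log n / 4)) := by positivity
  have hmom := measureReal_forall_notMem_le_inv_sum (μ := μ) (s := t) (E := E)
    (fun z _ => (hη n).nullMeasurable _ (hcapm z))
    (fun y hy z hz hyz => by
      have h4 := (hη n).union_le _ _ (hcapm y) (hcapm z) (hdisj y hy z hz hyz)
      have e1 : E y ∩ E z = {ω | Disjoint (η n ω) (cap y ∪ cap z)} := by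
        ext ω; exact Set.disjoint_union_right.symm
      rw [e1]
      exact h4) (hSpos.trans_le hS)
  calc containmentProb D ρ μ (η n) δ ≤ μ.real {ω | ∀ z ∈ t, ω ∉ E z} :=
        measureReal_mono (fun ω hω z _ =>
          not_disjoint_of_inducedPolyhedron_subset h ((hη n).finite ω) hω z.2) (measure_ne_top _ _)
    _ ≤ (∑ z ∈ t, μ.real (E z))⁻¹ := hmom
    _ ≤ (m₀ / (C * σ ^ (e + 1)) * Real.exp (-(Real.log n / 4)))⁻¹ := by gcongr
    _ = _ := by
      rw [hσpow, Real.exp_neg, mul_inv, inv_inv, inv_div]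
      ring

/-- Large tubes: a Euclidean net of polynomial size, whose caps are all hit by the sample with
overwhelming probability, guarantees that the tubes cover the boundary. -/
theorem one_sub_containmentProb_isBigO (h : IsDefiningFunction D ρ) (hDb : Bornology.IsBounded D)
    (hf : IsBoundedDensity D f) (α : ℝ) :
    ∃ C > 0, ∀ g : frontier D → ℝ, (∀ w, 0 < g w) → C < (⨅ w, g w) →
      ∀ {Ω : Type*} [MeasurableSpace Ω] (μ : Measure Ω) [IsProbabilityMeasure μ]
        (η : ℕ → Ω → Set (frontier D)),
        (∀ n : ℕ, HasVoidBounds (sampleLaw D f) μ (η n) n) →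
        (fun n : ℕ => 1 - containmentProb D ρ μ (η n) (scaledSize g n))
          =O[atTop] fun n : ℕ => (n : ℝ) ^ (-α) := by
  obtain ⟨K, hK, k, hk, s₁, hs₁, hLB⟩ := exists_le_sampleLaw_cap h hDb hf
  have hprob := isProbabilityMeasure_sampleLaw hf
  set P := sampleLaw D f with hP
  have : CompactSpace (frontier D) := isCompact_iff_compactSpace.1 (isCompact_frontier hDb)
  -- the net has at most `O(n²)` points, so the caps should be missed with probability `n^(-α-2)`
  set b := max 1 ((α + 2) / k) with hb
  have hb1 : 1 ≤ b := le_max_left _ _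
  have hbk : α + 2 ≤ k * b ^ (e + 1) := by
    have h1 : (α + 2) / k ≤ b := le_max_right _ _
    have h2 : b ≤ b ^ (e + 1) := le_self_pow₀ hb1 (by omega)
    rw [div_le_iff₀ hk] at h1
    calc α + 2 ≤ b * k := h1
      _ ≤ b ^ (e + 1) * k := by gcongr
      _ = _ := mul_comm _ _
  refine ⟨(K + 1) * b, by positivity, fun g hgpos hgC Ω _ μ _ η hη => ?_⟩
  have hgw : ∀ w, (K + 1) * b ≤ g w := fun w =>
    hgC.le.trans (ciInf_le ⟨0, by rintro _ ⟨w, rfl⟩; exact (hgpos w).le⟩ w)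
  have ht := tendsto_tubeScale (d := e + 1) (by omega)
  have hev1 : ∀ᶠ n in atTop, b * tubeScale (e + 1) n < s₁ :=
    (by simpa using ht.const_mul b : Tendsto (fun n => b * tubeScale (e + 1) n) atTop (𝓝 0))
      |>.eventually_lt_const hs₁
  have hev2 : ∀ᶠ n in atTop, b * tubeScale (e + 1) n < 4 * K :=
    (by simpa using ht.const_mul b : Tendsto (fun n => b * tubeScale (e + 1) n) atTop (𝓝 0))
      |>.eventually_lt_const (by positivity)
  refine IsBigO.of_bound ((4 * K) ^ (e + 1) / k) ?_
  filter_upwards [hev1, hev2, eventually_ge_atTop 3] with n h1 h2 hn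
  set a := tubeScale (e + 1) n with ha
  have hapos : 0 < a := tubeScale_pos _ (by omega)
  have hn3 : (3 : ℝ) ≤ n := by exact_mod_cast hn
  have hn0 : (0 : ℝ) < n := by positivity
  have hlog : 1 ≤ Real.log n := by
    rw [Real.le_log_iff_exp_le hn0]
    linarith [Real.exp_one_lt_d9]
  have hapow : a ^ (e + 1) = Real.log n / n := tubeScale_pow (by omega) n
  set s := b * a with hs
  have hspos : 0 < s := by positivity
  have hspow : s ^ (e + 1) = b ^ (e + 1) * (Real.log n / n) := by rw [hs, mul_pow, hapow]
  obtain ⟨t, -, htsep, htcov⟩ := exists_finset_separated_cover (Set.univ : Set (frontier D)) hspos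
  set cap : frontier D → Set (frontier D) := fun z =>
    {w | ‖tangentFunctional ρ z w‖ ≤ K * s} with hcap
  have hcapm : ∀ z, MeasurableSet (cap z) := fun z => measurableSet_tube h continuous_const z
  have hcard : t.card * (k * (s ^ 2 / (4 * K)) ^ (e + 1)) ≤ 1 := by
    refine card_mul_le_one_of_disjoint (P := P)
      (B := fun z => (Metric.closedBall z (s / 2) : Set (frontier D)))
      (fun z _ => Metric.isClosed_closedBall.measurableSet) ?_ fun z _ => ?_
    · intro y hy z hz hyz
      refine Set.disjoint_left.2 fun w hwy hwz => ?_
      have h3 := htsep y hy z hz hyz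
      have h4 := dist_triangle_left y z w
      rw [Metric.mem_closedBall] at hwy hwz
      linarith
    · have h3 : s ^ 2 / (4 * K) ≤ s₁ := by
        rw [div_le_iff₀ (by positivity), sq]
        calc s * s ≤ s₁ * (4 * K) := by gcongr
          _ = _ := rfl
      refine (hLB z z.2 _ (by positivity) h3).trans (measureReal_mono ?_ (measure_ne_top _ _))
      rintro w ⟨hw, -⟩
      rw [Metric.mem_closedBall, Subtype.dist_eq, dist_eq_norm]
      refine (pow_le_pow_iff_left₀ (norm_nonneg _) (by positivity) two_ne_zero).1 (hw.trans_eq ?_)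
      field_simp
      ring
  have hcard' : (t.card : ℝ) ≤ (4 * K) ^ (e + 1) / k * n ^ 2 := by
    have h3 : 1 ≤ (s ^ (e + 1)) ^ 2 * n ^ 2 := by
      rw [hspow, ← mul_pow]
      refine one_le_pow₀ ?_
      have h4 : 1 ≤ b ^ (e + 1) := one_le_pow₀ hb1
      calc (1 : ℝ) ≤ b ^ (e + 1) * Real.log n := one_le_mul_of_one_le_of_one_le h4 hlog
        _ = _ := by field_simp
    have e1 : (s ^ 2 / (4 * K)) ^ (e + 1) = (s ^ (e + 1)) ^ 2 / (4 * K) ^ (e + 1) := by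
      rw [div_pow, ← pow_mul, ← pow_mul, mul_comm]
    rw [e1] at hcard
    have h5 : t.card * (s ^ (e + 1)) ^ 2 ≤ (4 * K) ^ (e + 1) / k := by
      rw [le_div_iff₀ hk, ← one_mul ((4 * K) ^ (e + 1)), ← div_le_iff₀ (by positivity)]
      calc _ = t.card * (k * ((s ^ (e + 1)) ^ 2 / (4 * K) ^ (e + 1))) := by ring
        _ ≤ 1 := hcard
    calc (t.card : ℝ) ≤ t.card * ((s ^ (e + 1)) ^ 2 * n ^ 2) :=
          le_mul_of_one_le_right (Nat.cast_nonneg _) h3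
      _ = t.card * (s ^ (e + 1)) ^ 2 * n ^ 2 := by ring
      _ ≤ _ := by gcongr
  set E : frontier D → Set Ω := fun z => {ω | Disjoint (η n ω) (cap z)} with hE
  have hEv : ∀ z ∈ t, μ.real (E z) ≤ (n : ℝ) ^ (-(α + 2)) := by
    intro z _
    refine ((hη n).le_exp _ (hcapm z)).trans ?_
    rw [Real.rpow_def_of_pos hn0, Real.exp_le_exp, mul_neg, neg_le_neg_iff]
    have h3 : k * s ^ (e + 1) ≤ P.real (cap z) :=
      (hLB z z.2 s hspos h1.le).trans (measureReal_mono (fun w hw => hw.2) (measure_ne_top _ _))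
    calc Real.log n * (α + 2) ≤ Real.log n * (k * b ^ (e + 1)) := by gcongr
      _ = n * (k * s ^ (e + 1)) := by rw [hspow]; field_simp
      _ ≤ _ := by gcongr
  have hcover : (Set.univ : Set Ω) ⊆ {ω | inducedPolyhedron D ρ (η n ω) (scaledSize g n) ⊆ D}
      ∪ ⋃ z ∈ t, E z := by
    intro ω _
    by_cases hω : ∃ z ∈ t, ω ∈ E z
    · obtain ⟨z, hz, hωz⟩ := hω
      exact Or.inr (Set.mem_biUnion hz hωz)
    · push Not at hω
      refine Or.inl (inducedPolyhedron_subset_of_cover h fun z hz => ?_)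
      obtain ⟨y, hy, hzy⟩ := htcov ⟨z, hz⟩ trivial
      obtain ⟨w, hw, hwy⟩ := Set.not_disjoint_iff.1 (hω y hy)
      refine ⟨w, hw, (norm_tangentFunctional_le_add ρ z y w).trans ?_⟩
      rw [Subtype.dist_eq, dist_eq_norm, norm_sub_rev] at hzy
      have hwy' : ‖tangentFunctional ρ y w‖ ≤ K * s := hwy
      calc _ ≤ K * s + s := add_le_add hwy' hzy
        _ = (K + 1) * b * a := by rw [hs]; ring
        _ ≤ g w * a := by gcongr; exact hgw w
  have hone : 1 ≤ containmentProb D ρ μ (η n) (scaledSize g n)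
      + t.card * (n : ℝ) ^ (-(α + 2)) := by
    calc (1 : ℝ) = μ.real Set.univ := by simp
      _ ≤ _ := measureReal_mono hcover (measure_ne_top _ _)
      _ ≤ _ := measureReal_union_le _ _
      _ ≤ _ := by
        refine add_le_add le_rfl ((measureReal_biUnion_finset_le _ _).trans ?_)
        rw [← nsmul_eq_mul]
        exact Finset.sum_le_card_nsmul t _ _ hEv
  have hle1 : containmentProb D ρ μ (η n) (scaledSize g n) ≤ 1 := measureReal_le_one
  rw [Real.norm_of_nonneg (by linarith), Real.norm_of_nonneg (by positivity)]
  calc _ ≤ t.card * (n : ℝ) ^ (-(α + 2)) := by linarith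
    _ ≤ (4 * K) ^ (e + 1) / k * n ^ 2 * (n : ℝ) ^ (-(α + 2)) := by gcongr
    _ = _ := by
      rw [mul_assoc, ← Real.rpow_natCast (n : ℝ) 2, ← Real.rpow_add hn0]
      congr 2
      push_cast
      ring

end Asymptotic

theorem proposition2p6 {d : ℕ} (hd : 2 ≤ d) (D : Set (Cd d)) (hD : IsStronglyCConvexDomain D)
    (hDb : Bornology.IsBounded D) (f : frontier D → ℝ) (hf : IsBoundedDensity D f) :
    (∃ c : ℝ, 0 < c ∧
      ∀ ρ : Cd d → ℝ, IsDefiningFunction D ρ →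
      ∀ g : frontier D → ℝ, Continuous g → (∀ w, 0 < g w) → (⨅ w, g w) < c →
      ∀ (Ω : Type*) [MeasurableSpace Ω] (μ : Measure Ω) [IsProbabilityMeasure μ]
        (W : ℕ → Ω → frontier D), IsIIDSample f μ W →
        (∀ N : ℕ → Ω → ℕ, IsPoissonCount μ W N →
          Tendsto (fun n : ℕ => containmentProb D ρ μ (poissonProcess W N n) (scaledSize g n))
            atTop (𝓝 0)) ∧
        Tendsto (fun n : ℕ => containmentProb D ρ μ (binomialProcess W n) (scaledSize g n))
          atTop (𝓝 0)) ∧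
    (∀ α : ℝ, 0 < α → ∃ C : ℝ, 0 < C ∧
      ∀ ρ : Cd d → ℝ, IsDefiningFunction D ρ →
      ∀ g : frontier D → ℝ, Continuous g → (∀ w, 0 < g w) → C < (⨅ w, g w) →
      ∀ (Ω : Type*) [MeasurableSpace Ω] (μ : Measure Ω) [IsProbabilityMeasure μ]
        (W : ℕ → Ω → frontier D), IsIIDSample f μ W →
        (∀ N : ℕ → Ω → ℕ, IsPoissonCount μ W N →
          (fun n : ℕ =>
            1 - containmentProb D ρ μ (poissonProcess W N n) (scaledSize g n))
              =O[atTop] fun n : ℕ => (n : ℝ) ^ (-α)) ∧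
        (fun n : ℕ => 1 - containmentProb D ρ μ (binomialProcess W n) (scaledSize g n))
          =O[atTop] fun n : ℕ => (n : ℝ) ^ (-α)) := by
  obtain ⟨e, rfl⟩ : ∃ e, d = e + 1 := ⟨d - 1, by omega⟩
  obtain ⟨ρ₀, h₀, hH⟩ := hD.exists_defining
  have := isProbabilityMeasure_sampleLaw hf
  refine ⟨?_, fun α _ => ?_⟩
  · obtain ⟨c, hc, hmain⟩ := tendsto_containmentProb_zero h₀ hDb hD.isConnected hf hH
    refine ⟨c, hc, fun ρ hρ g hg hgpos hgc Ω _ μ _ W hW => ?_⟩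
    simp only [containmentProb_congr h₀ hρ]
    exact ⟨fun N hN => hmain g hg hgpos hgc μ _ fun n =>
        hasVoidBounds_image_Iio_poisson hW.law hW.indep (hN.law n) (hN.indep n),
      hmain g hg hgpos hgc μ _ fun n => hasVoidBounds_image_Iio hW.law hW.indep n⟩
  · obtain ⟨C, hC, hmain⟩ := one_sub_containmentProb_isBigO h₀ hDb hf α
    refine ⟨C, hC, fun ρ hρ g hg hgpos hgC Ω _ μ _ W hW => ?_⟩
    simp only [containmentProb_congr h₀ hρ]
    exact ⟨fun N hN => hmain g hgpos hgC μ _ fun n =>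
        hasVoidBounds_image_Iio_poisson hW.law hW.indep (hN.law n) (hN.indep n),
      hmain g hgpos hgC μ _ fun n => hasVoidBounds_image_Iio hW.law hW.indep n⟩
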